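/- Let $\mathfrak M$ be a saturated model of a complete, possibly many-sorted, first-order theory: every finitely satisfiable set of formulas in finitely many variables over a parameter set of size $<|\mathfrak M|$ is realized in $\mathfrak M$. Let $A\subseteq\mathfrak M$ with $|A|<|\mathfrak M|$, and let $S(A)$ be the set of complete types over $A$ in finitely many variables (of arbitrary sorts). "Definable" means definable with parameters from $\mathfrak M$. For $p\in S(A)$ let $p(\mathfrak M)$ be its set of realizations; a subset of $p(\mathfrak M)$ (or of $p(\mathfrak M)^2$) is relatively ($A$-)definable if it is the trace of an ($A$-)definable set. A type $p\in S(A)$ is *stationarily ordered* (an *so-type*) if there is a relatively $A$-definable linear order $<$ on $p(\mathfrak M)$ such that for every relatively definable $D\subseteq p(\mathfrak M)$, exactly one of $D$ and $p(\mathfrak M)\smallsetminus D$ contains a non-empty initial part of $(p(\mathfrak M),<)$, and exactly one of them contains a non-empty final part. For $p,q\in S(A)$ write $p\perp^w q$ (weakly orthogonal) if $p(x)\cup q(y)$, with $x,y$ disjoint, determines a complete type over $A$; and $p\perp^f q$ (forking orthogonal) if for all $a\models p$ and $b\models q$ the type $\mathrm{tp}(a/Ab)$ does not fork over $A$. Write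 $p\not\perp^w q$, $p\not\perp^f q$ for the negations. **Proposition.** Let $p,q\in S(A)$ be so-types. (i) If $p\not\perp^w q$, then for all $r\in S(A)$: $p\perp^w r \Leftrightarrow q\perp^w r$. (ii) If $p\not\perp^f q$, then for all $r\in S(A)$: $p\perp^f r \Leftrightarrow q\perp^f r$. -/

import Mathlib

open Cardinal

universe u v v' w

namespace ManySorted

/-- A many-sorted first-order language; the one-sorted case is `Sorts = Unit`. Symbols carry the
sorts of their arguments and, for functions, the sort of their value. -/
structure Language where
  Sorts : Type u
  Functions : (n : ℕ) → (Fin n → Sorts) → Sorts → Type v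
  Relations : (n : ℕ) → (Fin n → Sorts) → Type v'

/-- An `L`-structure with universe `M s` in the sort `s`. -/
class Structure (L : Language.{u, v, v'}) (M : L.Sorts → Type w) where
  funMap : ∀ {n : ℕ} {d : Fin n → L.Sorts} {s : L.Sorts},
    L.Functions n d s → (∀ i, M (d i)) → M s
  relMap : ∀ {n : ℕ} {d : Fin n → L.Sorts}, L.Relations n d → (∀ i, M (d i)) → Prop

variable {L : Language.{u, v, v'}} {M : L.Sorts → Type w}

/-- A tuple of elements of `M` whose coordinates have the sorts prescribed by `x`. -/
abbrev Tuple {α : Type} (M : L.Sorts → Type w) (x : α → L.Sorts) : Type w := ∀ i, M (x i)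

/-- The set of coordinates of a tuple, as a set of elements of `M` (of all sorts). -/
def Tuple.coords {α : Type} {x : α → L.Sorts} (a : Tuple M x) : Set (Σ s, M s) :=
  Set.range fun i => ⟨x i, a i⟩

/-- The concatenation `ab` of two tuples. -/
def Tuple.pair {α β : Type} {x : α → L.Sorts} {y : β → L.Sorts} (a : Tuple M x) (b : Tuple M y) :
    Tuple M (Sum.elim x y)
  | Sum.inl i => a i
  | Sum.inr j => b j

/-- The variable context `x` extended by one new variable `none`, of sort `s`. -/
def extendSorts {α : Type} (x : α → L.Sorts) (s : L.Sorts) : Option α → L.Sorts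
  | none => s
  | some i => x i

/-- The assignment `a` extended by the value `m` of the new variable. -/
def Tuple.extend {α : Type} {x : α → L.Sorts} {s : L.Sorts} (a : Tuple M x) (m : M s) :
    Tuple M (extendSorts x s)
  | none => m
  | some i => a i

/-- Terms with parameters from `A`, in the variables `i : α` of sort `x i`. -/
inductive Term (A : Set (Σ s, M s)) {α : Type} (x : α → L.Sorts) :
    L.Sorts → Type (max u v w)
  | var (i : α) : Term A x (x i)
  | param {s : L.Sorts} (m : M s) (hm : ⟨s, m⟩ ∈ A) : Term A x s
  | func {n : ℕ} {d : Fin n → L.Sorts} {s : L.Sorts} (f : L.Functions n d s)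
      (t : ∀ i, Term A x (d i)) : Term A x s

/-- `L_A`-formulas (parameters from `A`) whose free variables are among the variables `i : α` of
sort `x i`. For `A = ∅` these are the `L`-formulas, for `A = Set.univ` the `L_M`-formulas. -/
inductive Formula (A : Set (Σ s, M s)) :
    {α : Type} → (α → L.Sorts) → Type (max 1 u v v' w)
  | falsum {α : Type} {x : α → L.Sorts} : Formula A x
  | equal {α : Type} {x : α → L.Sorts} {s : L.Sorts} (t₁ t₂ : Term A x s) : Formula A x
  | rel {α : Type} {x : α → L.Sorts} {n : ℕ} {d : Fin n → L.Sorts} (R : L.Relations n d)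
      (t : ∀ i, Term A x (d i)) : Formula A x
  | imp {α : Type} {x : α → L.Sorts} (φ ψ : Formula A x) : Formula A x
  | all {α : Type} {x : α → L.Sorts} (s : L.Sorts) (φ : Formula A (extendSorts x s)) : Formula A x

/-- Negation. -/
def Formula.neg {A : Set (Σ s, M s)} {α : Type} {x : α → L.Sorts} (φ : Formula A x) :
    Formula A x :=
  φ.imp Formula.falsum

section Semantics

variable [Structure L M] {A : Set (Σ s, M s)}

/-- The value of a term at a tuple. -/
def Term.eval {α : Type} {x : α → L.Sorts} (a : Tuple M x) :
    {s : L.Sorts} → Term A x s → M s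
  | _, .var i => a i
  | _, .param m _ => m
  | _, .func f t => Structure.funMap f fun i => (t i).eval a

/-- `φ.Realize a` says `M ⊨ φ(a)`. -/
def Formula.Realize : {α : Type} → {x : α → L.Sorts} → Formula A x → Tuple M x → Prop
  | _, _, .falsum, _ => False
  | _, _, .equal t₁ t₂, a => t₁.eval a = t₂.eval a
  | _, _, .rel R t, a => Structure.relMap R fun i => (t i).eval a
  | _, _, .imp φ ψ, a => φ.Realize a → ψ.Realize a
  | _, _, .all _ φ, a => ∀ m, φ.Realize (a.extend m)

/-- A set of `L_A`-formulas is finitely satisfiable in `M` (that is, consistent with the theory of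
`M` with names for its elements). -/
def FinSat {α : Type} {x : α → L.Sorts} (S : Set (Formula A x)) : Prop :=
  ∀ F ⊆ S, F.Finite → ∃ a : Tuple M x, ∀ φ ∈ F, φ.Realize a

/-- A set of elements of `M` is small if its cardinality is less than that of `M`. -/
def Small (A : Set (Σ s, M s)) : Prop :=
  #A < #(Σ s, M s)

variable (M) in
/-- `M` is saturated: every finitely satisfiable set of formulas in finitely many variables, over
a small set of parameters, is realized in `M`. -/
def Saturated : Prop :=
  ∀ A : Set (Σ s, M s), Small A → ∀ (α : Type) [Finite α] (x : α → L.Sorts)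
    (S : Set (Formula A x)), FinSat S → ∃ a : Tuple M x, ∀ φ ∈ S, φ.Realize a

/-- Complete types over `A` in the variables `x`. -/
structure CompleteType (A : Set (Σ s, M s)) {α : Type} (x : α → L.Sorts) where
  formulas : Set (Formula A x)
  finSat : FinSat formulas
  complete : ∀ φ : Formula A x, φ ∈ formulas ∨ φ.neg ∈ formulas

/-- The locus `p(M)`: the set of realizations of `p` in `M`. -/
def CompleteType.locus {α : Type} {x : α → L.Sorts} (p : CompleteType A x) : Set (Tuple M x) :=
  {a | ∀ φ ∈ p.formulas, φ.Realize a}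

/-- The set of formulas `tp(a/A)`. -/
def tp (A : Set (Σ s, M s)) {α : Type} {x : α → L.Sorts} (a : Tuple M x) : Set (Formula A x) :=
  {φ | φ.Realize a}

/-! ### Stationarily ordered types -/

/-- `D` contains a non-empty initial part of `(X, r)`. -/
def LeftEventual {X : Type*} (r : X → X → Prop) (D : Set X) : Prop :=
  ∃ I ⊆ D, I.Nonempty ∧ ∀ a ∈ I, ∀ b, r b a → b ∈ I

/-- `D` contains a non-empty final part of `(X, r)`. -/
def RightEventual {X : Type*} (r : X → X → Prop) (D : Set X) : Prop :=
  ∃ I ⊆ D, I.Nonempty ∧ ∀ a ∈ I, ∀ b, r a b → b ∈ I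

/-- The binary relation on `p(M)` relatively defined by the formula `φ(x, x')`. -/
def CompleteType.relOn {α : Type} {x : α → L.Sorts} (p : CompleteType A x)
    (φ : Formula A (Sum.elim x x)) (a b : p.locus) : Prop :=
  φ.Realize (Tuple.pair a.1 b.1)

/-- The subset of `p(M)` relatively defined by the formula `ψ(x)`, with parameters from `M`. -/
def CompleteType.subsetOn {α : Type} {x : α → L.Sorts} (p : CompleteType A x)
    (ψ : Formula (Set.univ : Set (Σ s, M s)) x) : Set p.locus :=
  {a | ψ.Realize a.1}

/-- `p` is stationarily ordered: some relatively `A`-definable linear order on `p(M)` is such that,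
for every relatively definable `D ⊆ p(M)`, exactly one of `D` and its complement in `p(M)` is
left-eventual, and exactly one of them is right-eventual. -/
def CompleteType.IsSO {α : Type} {x : α → L.Sorts} (p : CompleteType A x) : Prop :=
  ∃ φ : Formula A (Sum.elim x x), IsStrictTotalOrder p.locus (p.relOn φ) ∧
    ∀ ψ : Formula (Set.univ : Set (Σ s, M s)) x,
      Xor (LeftEventual (p.relOn φ) (p.subsetOn ψ)) (LeftEventual (p.relOn φ) (p.subsetOn ψ)ᶜ) ∧
      Xor (RightEventual (p.relOn φ) (p.subsetOn ψ)) (RightEventual (p.relOn φ) (p.subsetOn ψ)ᶜ)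

/-! ### Weak orthogonality -/

/-- `p(x) ∪ q(y) ⊢ φ(x, y)`, where `x` and `y` are disjoint; consequence is modulo the theory of `M`
with names for its elements. -/
def CompleteType.UnionEntails {α β : Type} {x : α → L.Sorts} {y : β → L.Sorts}
    (p : CompleteType A x) (q : CompleteType A y) (φ : Formula A (Sum.elim x y)) : Prop :=
  ∃ F ⊆ p.formulas, F.Finite ∧ ∃ G ⊆ q.formulas, G.Finite ∧
    ∀ (a : Tuple M x) (b : Tuple M y), (∀ θ ∈ F, θ.Realize a) → (∀ θ ∈ G, θ.Realize b) →
      φ.Realize (a.pair b)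

/-- `p ⊥ʷ q`: `p(x) ∪ q(y)` determines a complete type over `A`. -/
def CompleteType.WeaklyOrthogonal {α β : Type} {x : α → L.Sorts} {y : β → L.Sorts}
    (p : CompleteType A x) (q : CompleteType A y) : Prop :=
  ∀ φ : Formula A (Sum.elim x y), p.UnionEntails q φ ∨ p.UnionEntails q φ.neg

/-! ### Forking -/

/-- The formula `φ(x, b)` divides over `A`: there are a sequence of realizations `b₀, b₁, …` of
`tp(b/A)` and a positive `k` such that any `k` of the formulas `φ(x, bᵢ)` are inconsistent. -/
def Divides (A : Set (Σ s, M s)) {α β : Type} {x : α → L.Sorts} {y : β → L.Sorts}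
    (φ : Formula (∅ : Set (Σ s, M s)) (Sum.elim x y)) (b : Tuple M y) : Prop :=
  ∃ c : ℕ → Tuple M y, (∀ i, tp A (c i) = tp A b) ∧
    ∃ k > 0, ∀ I : Finset ℕ, I.card = k →
      ¬ ∃ a : Tuple M x, ∀ i ∈ I, φ.Realize (a.pair (c i))

/-- A set `S` of `L_B`-formulas forks over `A`: it implies (modulo the theory of `M` with names for
its elements) a finite disjunction of formulas that divide over `A`. -/
def Forks (A : Set (Σ s, M s)) {B : Set (Σ s, M s)} {α : Type} {x : α → L.Sorts}
    (S : Set (Formula B x)) : Prop :=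
  ∃ (N : ℕ) (len : Fin N → ℕ) (y : ∀ j, Fin (len j) → L.Sorts)
    (φ : ∀ j, Formula (∅ : Set (Σ s, M s)) (Sum.elim x (y j))) (b : ∀ j, Tuple M (y j)),
    (∀ j, Divides A (φ j) (b j)) ∧
    ∃ F ⊆ S, F.Finite ∧
      ∀ a : Tuple M x, (∀ θ ∈ F, θ.Realize a) → ∃ j, (φ j).Realize (a.pair (b j))

/-- `a` is independent from `b` over `A`: the type `tp(a/Ab)` does not fork over `A`. -/
def Indep (A : Set (Σ s, M s)) {α β : Type} {x : α → L.Sorts} {y : β → L.Sorts}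
    (a : Tuple M x) (b : Tuple M y) : Prop :=
  ¬ Forks A (tp (A ∪ b.coords) a)

/-- `p ⊥ᶠ q`: every realization of `p` is independent over `A` from every realization of `q`. -/
def CompleteType.ForkingOrthogonal {α β : Type} {x : α → L.Sorts} {y : β → L.Sorts}
    (p : CompleteType A x) (q : CompleteType A y) : Prop :=
  ∀ a ∈ p.locus, ∀ b ∈ q.locus, Indep A a b

end Semantics

end ManySorted

/-! Both parts reduce to transitivity of non-orthogonality: if p is non-orthogonal to q and to r,
then q is non-orthogonal to r. With symmetry between p and q, the two equivalences follow by
contraposition. Automorphisms over A are replaced by homogeneity (`exists_tp_pair_eq`,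
`exists_conj`), and compactness replaces p(M) by an A-definable neighbourhood.

Weak case. If some b ⊨ q splits p(M), stationarity of p makes the splitting formula or its negation
hold on an initial part of p(M), so b A-defines a proper non-empty cut of p(M)
(`exists_initial_cut`); some c ⊨ r does the same. Whether the cut of c is contained in the cut of b
is an A-definable relation. Moving b within q makes it fail and hold for the same c, so b and c are
not weakly orthogonal.

Forking case. For an so-type p, the type of a ⊨ p over Ac forks over A iff it contains a formula
bounded on both sides in p(M). A formula true near an end of p(M) cannot divide, because its
conjugates are also true near that end and so finitely many of them meet (`exists_bound_of_forks`).
A bounded formula can be translated repeatedly past its upper bound, giving pairwise disjoint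
conjugates (`forks_of_bound`).

Now let P(x,b) and R(x,c) be bounded in p(M), with b ⊨ q and c ⊨ r. The set K(y,c) of those y for
which P(x,y) meets R(x,c) is bounded in q(M): as y runs from one end of q(M) to the other, P(x,y)
passes from one side of R(x,c) to the other. This uses that a nested A-definable family of non-empty
subsets of q(M), indexed by p(M), has no bounded member (`not_bounded_of_nested`). A suitable
conjugate of b lies in K(y,c), so q and r are not forking orthogonal. Symmetry is the case r = p. -/

namespace ManySorted

variable {L : Language.{u, v, v'}} {M : L.Sorts → Type w} {A B : Set (Σ s, M s)}
  {α β γ : Type} {x : α → L.Sorts} {y : β → L.Sorts} {z : γ → L.Sorts}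

/-! ### Projections of tuples -/

/-- The first component of a concatenated tuple. -/
def Tuple.fst (t : Tuple M (Sum.elim x y)) : Tuple M x := fun i => t (Sum.inl i)

/-- The second component of a concatenated tuple. -/
def Tuple.snd (t : Tuple M (Sum.elim x y)) : Tuple M y := fun i => t (Sum.inr i)

theorem Tuple.pair_fst_snd (t : Tuple M (Sum.elim x y)) :
    Tuple.pair (M := M) t.fst t.snd = t := by
  funext i; cases i <;> rfl

/-- The restriction of an assignment to the old variables. -/
def Tuple.restrict {s : L.Sorts} (t : Tuple M (extendSorts x s)) : Tuple M x := fun i => t (some i)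

theorem Tuple.coords_pair (a : Tuple M x) (b : Tuple M y) :
    (a.pair b).coords = a.coords ∪ b.coords := by
  ext ⟨s, m⟩
  constructor
  · rintro ⟨i | i, h⟩
    · exact Or.inl ⟨i, h⟩
    · exact Or.inr ⟨i, h⟩
  · rintro (⟨i, h⟩ | ⟨i, h⟩)
    · exact ⟨Sum.inl i, h⟩
    · exact ⟨Sum.inr i, h⟩

variable [Structure L M]

/-! ### Translation of terms and formulas -/

theorem Term.exists_translate {s : L.Sorts} (T : Set (Tuple M y)) (ρ : Tuple M y → Tuple M x)
    (hvar : ∀ i, ∃ t : Term B y (x i), ∀ b ∈ T, t.eval b = ρ b i)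
    (hparam : ∀ (s : L.Sorts) (m : M s), ⟨s, m⟩ ∈ A → ∃ t : Term B y s, ∀ b ∈ T, t.eval b = m)
    (t : Term A x s) : ∃ t' : Term B y s, ∀ b ∈ T, t'.eval b = t.eval (ρ b) := by
  induction t with
  | var i => exact hvar i
  | param m hm => exact hparam _ m hm
  | func f t ih =>
    choose t' ht' using ih
    refine ⟨.func f t', fun b hb => ?_⟩
    simp only [Term.eval, ht' _ b hb]

/-- Agreement is required only on `T`, so that a parameter may be traded for a variable whose value
on `T` is that parameter. -/
theorem Formula.exists_translate (φ : Formula A x) {β : Type} {y : β → L.Sorts}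
    (T : Set (Tuple M y)) (ρ : Tuple M y → Tuple M x)
    (hvar : ∀ i, ∃ t : Term B y (x i), ∀ b ∈ T, t.eval b = ρ b i)
    (hparam : ∀ (s : L.Sorts) (m : M s), ⟨s, m⟩ ∈ A → ∃ t : Term B y s, ∀ b ∈ T, t.eval b = m) :
    ∃ φ' : Formula B y, ∀ b ∈ T, φ'.Realize b ↔ φ.Realize (ρ b) := by
  induction φ generalizing β with
  | falsum => exact ⟨.falsum, fun b _ => Iff.rfl⟩
  | equal t₁ t₂ =>
    obtain ⟨t₁', h₁⟩ := t₁.exists_translate T ρ hvar hparam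
    obtain ⟨t₂', h₂⟩ := t₂.exists_translate T ρ hvar hparam
    refine ⟨.equal t₁' t₂', fun b hb => ?_⟩
    simp only [Formula.Realize, h₁ b hb, h₂ b hb]
  | rel R t =>
    choose t' ht' using fun i => (t i).exists_translate T ρ hvar hparam
    refine ⟨.rel R t', fun b hb => ?_⟩
    simp only [Formula.Realize, ht' _ b hb]
  | imp φ ψ ihφ ihψ =>
    obtain ⟨φ', h₁⟩ := ihφ T ρ hvar hparam
    obtain ⟨ψ', h₂⟩ := ihψ T ρ hvar hparam
    refine ⟨.imp φ' ψ', fun b hb => ?_⟩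
    simp only [Formula.Realize, h₁ b hb, h₂ b hb]
  | all s φ ih =>
    have weaken : ∀ {s' : L.Sorts} (t : Term B y s'), ∃ t' : Term B (extendSorts y s) s',
        ∀ b : Tuple M (extendSorts y s), t'.eval b = t.eval b.restrict := by
      intro s' t
      obtain ⟨t', ht'⟩ := t.exists_translate (B := B) Set.univ
        (Tuple.restrict (M := M) (s := s))
        (fun i => ⟨.var (x := extendSorts y s) (some i), fun b _ => rfl⟩)
        (fun s m hm => ⟨.param m hm, fun b _ => rfl⟩)
      exact ⟨t', fun b => ht' b trivial⟩
    obtain ⟨φ', h⟩ := ih (y := extendSorts y s) {b | Tuple.restrict b ∈ T}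
      (fun b => (ρ b.restrict).extend (b none : M s))
      (by
        rintro (_ | i)
        · exact ⟨.var (x := extendSorts y s) none, fun b _ => rfl⟩
        · obtain ⟨t, ht⟩ := hvar i
          obtain ⟨t', ht'⟩ := weaken t
          exact ⟨t', fun b hb => (ht' b).trans (ht _ hb)⟩)
      (by
        intro s' m hm
        obtain ⟨t, ht⟩ := hparam s' m hm
        obtain ⟨t', ht'⟩ := weaken t
        exact ⟨t', fun b hb => (ht' b).trans (ht _ hb)⟩)
    refine ⟨.all s φ', fun b hb => ?_⟩
    simp only [Formula.Realize]
    exact forall_congr' fun m => h (b.extend m) hb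

/-! ### Definable predicates -/

/-- The predicate `P` on tuples is definable with parameters from `B`. -/
def DefPred (B : Set (Σ s, M s)) (P : Tuple M y → Prop) : Prop :=
  ∃ φ : Formula B y, ∀ b, φ.Realize b ↔ P b

/-- The binary relation `R` between tuples is definable with parameters from `B`. -/
def DefRel (B : Set (Σ s, M s)) (R : Tuple M x → Tuple M y → Prop) : Prop :=
  DefPred B fun t : Tuple M (Sum.elim x y) => R t.fst t.snd

/-- The map `ρ` between tuples is given coordinatewise by terms with parameters from `B`. -/
def TermMap (B : Set (Σ s, M s)) (ρ : Tuple M y → Tuple M x) : Prop :=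
  ∀ i, ∃ t : Term B y (x i), ∀ b, t.eval b = ρ b i

theorem TermMap.id : TermMap B (fun b : Tuple M y => b) :=
  fun i => ⟨.var i, fun _ => rfl⟩

theorem TermMap.const {c : Tuple M x} (hc : c.coords ⊆ B) : TermMap B (fun _ : Tuple M y => c) :=
  fun i => ⟨.param (c i) (hc ⟨i, rfl⟩), fun _ => rfl⟩

theorem TermMap.fst {ρ : Tuple M z → Tuple M (Sum.elim x y)} (h : TermMap B ρ) :
    TermMap B fun t => (ρ t).fst :=
  fun i => h (Sum.inl i)

theorem TermMap.snd {ρ : Tuple M z → Tuple M (Sum.elim x y)} (h : TermMap B ρ) :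
    TermMap B fun t => (ρ t).snd :=
  fun i => h (Sum.inr i)

theorem TermMap.pair {ρ : Tuple M z → Tuple M x} {σ : Tuple M z → Tuple M y}
    (hρ : TermMap B ρ) (hσ : TermMap B σ) : TermMap B fun c => (ρ c).pair (σ c)
  | Sum.inl i => hρ i
  | Sum.inr i => hσ i

theorem DefPred.comp {P : Tuple M x → Prop} (hP : DefPred A P) (hAB : A ⊆ B)
    {ρ : Tuple M y → Tuple M x} (hρ : TermMap B ρ) : DefPred B fun b => P (ρ b) := by
  obtain ⟨φ, hφ⟩ := hP
  obtain ⟨φ', h⟩ := φ.exists_translate (B := B) Set.univ ρ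
    (fun i => (hρ i).imp fun _ h b _ => h b) (fun s m hm => ⟨.param m (hAB hm), fun _ _ => rfl⟩)
  exact ⟨φ', fun b => (h b trivial).trans (hφ _)⟩

theorem DefPred.mono {P : Tuple M x → Prop} (hP : DefPred A P) (hAB : A ⊆ B) : DefPred B P :=
  hP.comp hAB TermMap.id

theorem DefRel.comp {R : Tuple M x → Tuple M y → Prop} (hR : DefRel A R) (hAB : A ⊆ B)
    {ρ : Tuple M z → Tuple M x} {σ : Tuple M z → Tuple M y} (hρ : TermMap B ρ)
    (hσ : TermMap B σ) : DefPred B fun c => R (ρ c) (σ c) :=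
  DefPred.comp hR hAB (hρ.pair hσ)

theorem Formula.defPred (φ : Formula B y) : DefPred B fun b => φ.Realize b :=
  ⟨φ, fun _ => Iff.rfl⟩

theorem Formula.defRel (φ : Formula B (Sum.elim x y)) : DefRel B fun a b => φ.Realize (a.pair b) := by
  refine ⟨φ, fun t => ?_⟩
  change _ ↔ φ.Realize (Tuple.pair (M := M) t.fst t.snd)
  rw [Tuple.pair_fst_snd]

theorem DefPred.congr {P Q : Tuple M y → Prop} (hP : DefPred B P) (h : ∀ b, P b ↔ Q b) :
    DefPred B Q := by
  obtain ⟨φ, hφ⟩ := hP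
  exact ⟨φ, fun b => (hφ b).trans (h b)⟩

theorem DefPred.imp {P Q : Tuple M y → Prop} (hP : DefPred B P) (hQ : DefPred B Q) :
    DefPred B fun b => P b → Q b := by
  obtain ⟨φ, hφ⟩ := hP
  obtain ⟨ψ, hψ⟩ := hQ
  exact ⟨.imp φ ψ, fun b => imp_congr (hφ b) (hψ b)⟩

theorem DefPred.false : DefPred B fun _ : Tuple M y => False :=
  ⟨.falsum, fun _ => Iff.rfl⟩

theorem DefPred.not {P : Tuple M y → Prop} (hP : DefPred B P) : DefPred B fun b => ¬ P b :=
  hP.imp .false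

theorem DefPred.and {P Q : Tuple M y → Prop} (hP : DefPred B P) (hQ : DefPred B Q) :
    DefPred B fun b => P b ∧ Q b :=
  (hP.imp hQ.not).not.congr fun b => by tauto

theorem DefPred.or {P Q : Tuple M y → Prop} (hP : DefPred B P) (hQ : DefPred B Q) :
    DefPred B fun b => P b ∨ Q b :=
  (hP.not.imp hQ).congr fun b => by tauto

theorem DefPred.forall_mem_finite {ι : Type*} {F : Set ι} (hF : F.Finite)
    {P : ι → Tuple M y → Prop} (hP : ∀ i ∈ F, DefPred B (P i)) :
    DefPred B fun b => ∀ i ∈ F, P i b := by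
  induction F, hF using Set.Finite.induction_on with
  | empty => exact DefPred.false.not.congr fun b => by simp
  | insert _ _ ih =>
    exact ((hP _ (Set.mem_insert _ _)).and
      (ih fun i hi => hP i (Set.mem_insert_of_mem _ hi))).congr fun b => by simp

/-- The language quantifies one variable at a time, so a tuple is quantified by induction on its
length, which is why it is indexed by `Fin n`. -/
theorem DefRel.forall_snd {n : ℕ} {x : Fin n → L.Sorts} {R : Tuple M y → Tuple M x → Prop}
    (hR : DefRel B R) : DefPred B fun b => ∀ a, R b a := by
  induction n generalizing β y with
  | zero =>
    have hc : TermMap B (fun _ : Tuple M y => (fun i => i.elim0 : Tuple M x)) := fun i => i.elim0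
    refine (hR.comp subset_rfl TermMap.id hc).congr fun b => ⟨fun h a => ?_, fun h => h _⟩
    convert h using 1
  | succ n ih =>
    have hcons : TermMap B (fun t : Tuple M (Sum.elim (extendSorts y (x 0)) fun i => x (Fin.succ i)) =>
        (Fin.cons (t (Sum.inl none)) t.snd : Tuple M x)) := by
      intro i
      refine Fin.cases ?_ (fun i => ?_) i
      · exact ⟨.var (x := Sum.elim (extendSorts y (x 0)) fun i => x (Fin.succ i)) (Sum.inl none),
          fun b => rfl⟩
      · exact ⟨.var (x := Sum.elim (extendSorts y (x 0)) fun i => x (Fin.succ i)) (Sum.inr i),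
          fun b => rfl⟩
    have hres : TermMap B (fun t : Tuple M (Sum.elim (extendSorts y (x 0))
        fun i => x (Fin.succ i)) => t.fst.restrict) :=
      fun i => ⟨.var (x := Sum.elim (extendSorts y (x 0)) fun i => x (Fin.succ i))
        (Sum.inl (some i)), fun b => rfl⟩
    obtain ⟨φ, hφ⟩ := ih (y := extendSorts y (x 0)) (x := fun i => x (Fin.succ i))
      (R := fun b a => R b.restrict (Fin.cons (b none) a : Tuple M x))
      (hR.comp subset_rfl hres hcons)
    refine ⟨.all (x 0) φ, fun b => ⟨fun h a => ?_, fun h m => ?_⟩⟩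
    · have := (hφ _).1 (h (a 0)) (fun i => a (Fin.succ i))
      change R b (Fin.cons (a 0) (Fin.tail a) : Tuple M x) at this
      rwa [Fin.cons_self_tail] at this
    · exact (hφ _).2 fun a => h _

theorem DefRel.exists_snd {n : ℕ} {x : Fin n → L.Sorts} {R : Tuple M y → Tuple M x → Prop}
    (hR : DefRel B R) : DefPred B fun b => ∃ a, R b a := by
  have : DefRel B fun b a => ¬ R b a := DefPred.not hR
  exact this.forall_snd.not.congr fun b => by simp

/-- Parameters can be replaced by variables. -/
theorem DefPred.exists_defRel {c : Tuple M y} {P : Tuple M x → Prop}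
    (hP : DefPred (A ∪ c.coords) P) :
    ∃ R : Tuple M x → Tuple M y → Prop, DefRel A R ∧ ∀ a, R a c ↔ P a := by
  obtain ⟨φ, hφ⟩ := hP
  obtain ⟨φ', h⟩ := φ.exists_translate (B := A) {t : Tuple M (Sum.elim x y) | t.snd = c}
    Tuple.fst (fun i => ⟨.var (x := Sum.elim x y) (Sum.inl i), fun b _ => rfl⟩) (by
      rintro s m (hm | ⟨j, hj⟩)
      · exact ⟨.param m hm, fun _ _ => rfl⟩
      · cases hj
        exact ⟨.var (x := Sum.elim x y) (Sum.inr j), fun b hb => congrFun hb j⟩)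
  exact ⟨_, φ'.defRel, fun a => (h (a.pair c) rfl).trans (hφ a)⟩

theorem Term.exists_finite_params {s : L.Sorts} (t : Term A x s) :
    ∃ A₀ ⊆ A, A₀.Finite ∧ ∃ t' : Term A₀ x s, ∀ a, t'.eval a = t.eval a := by
  induction t with
  | var i => exact ⟨∅, Set.empty_subset _, Set.finite_empty, .var i, fun _ => rfl⟩
  | param m hm =>
    exact ⟨{⟨_, m⟩}, Set.singleton_subset_iff.2 hm, Set.finite_singleton _, .param m rfl,
      fun _ => rfl⟩
  | func f t ih =>
    choose A₀ hA hfin t' ht' using ih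
    have hsub : ∀ i, ∃ t'' : Term (⋃ i, A₀ i) x _, ∀ a, t''.eval a = (t i).eval a := fun i => by
      obtain ⟨t'', h⟩ := (t' i).exists_translate (B := ⋃ i, A₀ i) Set.univ (fun a => a)
        (fun i => ⟨.var i, fun _ _ => rfl⟩)
        (fun s m hm => ⟨.param m (Set.mem_iUnion_of_mem i hm), fun _ _ => rfl⟩)
      exact ⟨t'', fun a => (h a trivial).trans (ht' i a)⟩
    choose t'' ht'' using hsub
    refine ⟨_, Set.iUnion_subset hA, Set.finite_iUnion hfin, .func f t'', fun a => ?_⟩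
    simp only [Term.eval, ht'']

theorem Term.exists_mono {s : L.Sorts} (h : A ⊆ B) (t : Term A x s) :
    ∃ t' : Term B x s, ∀ a, t'.eval a = t.eval a := by
  obtain ⟨t', ht⟩ := t.exists_translate (B := B) Set.univ (fun a => a)
    (fun i => ⟨.var i, fun _ _ => rfl⟩) (fun s m hm => ⟨.param m (h hm), fun _ _ => rfl⟩)
  exact ⟨t', fun a => ht a trivial⟩

theorem Formula.exists_finite_params (φ : Formula A x) :
    ∃ A₀ ⊆ A, A₀.Finite ∧ DefPred A₀ fun a => φ.Realize a := by
  induction φ with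
  | falsum => exact ⟨∅, Set.empty_subset _, Set.finite_empty, .falsum, fun _ => Iff.rfl⟩
  | equal t₁ t₂ =>
    obtain ⟨A₁, h₁, f₁, t₁', e₁⟩ := t₁.exists_finite_params
    obtain ⟨A₂, h₂, f₂, t₂', e₂⟩ := t₂.exists_finite_params
    obtain ⟨t₁'', e₁'⟩ := t₁'.exists_mono (B := A₁ ∪ A₂) Set.subset_union_left
    obtain ⟨t₂'', e₂'⟩ := t₂'.exists_mono (B := A₁ ∪ A₂) Set.subset_union_right
    refine ⟨_, Set.union_subset h₁ h₂, f₁.union f₂, .equal t₁'' t₂'', fun a => ?_⟩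
    simp only [Formula.Realize, e₁, e₂, e₁', e₂']
  | rel R t =>
    choose A₀ hA hfin t' ht' using fun i => (t i).exists_finite_params
    choose t'' ht'' using fun i => (t' i).exists_mono (Set.subset_iUnion A₀ i)
    refine ⟨_, Set.iUnion_subset hA, Set.finite_iUnion hfin, .rel R t'', fun a => ?_⟩
    simp only [Formula.Realize, ht'', ht']
  | imp φ ψ ihφ ihψ =>
    obtain ⟨A₁, h₁, f₁, d₁⟩ := ihφ
    obtain ⟨A₂, h₂, f₂, d₂⟩ := ihψ
    exact ⟨_, Set.union_subset h₁ h₂, f₁.union f₂,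
      (d₁.mono Set.subset_union_left).imp (d₂.mono Set.subset_union_right)⟩
  | all s φ ih =>
    obtain ⟨A₁, h₁, f₁, ψ, hψ⟩ := ih
    exact ⟨A₁, h₁, f₁, .all s ψ, fun a => forall_congr' fun m => hψ _⟩

/-- A predicate definable over `A` is defined by a parameter-free formula at a tuple of `A`. -/
theorem DefPred.exists_tuple {P : Tuple M x → Prop} (hP : DefPred A P) :
    ∃ (k : ℕ) (u : Fin k → L.Sorts) (d : Tuple M u), d.coords ⊆ A ∧
      ∃ R : Tuple M x → Tuple M u → Prop, DefRel (∅ : Set (Σ s, M s)) R ∧ ∀ a, R a d ↔ P a := by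
  obtain ⟨φ, hφ⟩ := hP
  obtain ⟨A₀, hA, hfin, hdef⟩ := φ.exists_finite_params
  obtain ⟨k, f, hf⟩ : ∃ (k : ℕ) (f : Fin k → Σ s, M s), Set.range f = A₀ := by
    have := hfin.fin_param
    obtain ⟨k, f, -, hf⟩ := this
    exact ⟨k, f, hf⟩
  refine ⟨k, fun i => (f i).1, fun i => (f i).2, ?_, ?_⟩
  · rintro _ ⟨i, rfl⟩
    exact hA (hf ▸ ⟨i, rfl⟩)
  · have hc : (Tuple.coords (M := M) (fun i => (f i).2 : Tuple M fun i => (f i).1)) = A₀ := hf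
    rw [← hc, ← Set.empty_union (Tuple.coords _)] at hdef
    obtain ⟨R, hR, h⟩ := hdef.exists_defRel
    exact ⟨R, hR, fun a => (h a).trans (hφ a)⟩

/-! ### Saturation, compactness and homogeneity -/

/-- Every finitely satisfiable set of formulas over `B` in finitely many variables is realized. -/
def SaturatedOver (B : Set (Σ s, M s)) : Prop :=
  ∀ (α : Type) [Finite α] (x : α → L.Sorts) (S : Set (Formula B x)),
    FinSat S → ∃ a : Tuple M x, ∀ φ ∈ S, φ.Realize a

/-- There are finitely many tuples; if each refuted some formula of the set, those finitely many
formulas would be jointly unsatisfiable. -/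
theorem saturatedOver_of_finite [Finite (Σ s, M s)] (B : Set (Σ s, M s)) : SaturatedOver B := by
  intro α _ x S hS
  have : ∀ i, Finite (M (x i)) := fun i =>
    Finite.of_injective (fun m => (⟨x i, m⟩ : Σ s, M s)) sigma_mk_injective
  by_contra! h
  choose φ hφ hn using h
  obtain ⟨a, ha⟩ := hS (Set.range φ) (Set.range_subset_iff.2 hφ) (Set.finite_range φ)
  exact hn a (ha _ ⟨a, rfl⟩)

/-- Adding finitely many parameters is sure to preserve smallness only when the universe is
infinite, hence the separate finite case. -/
theorem Saturated.saturatedOver_union (hM : Saturated M) (hA : Small A) [Finite β]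
    (c : Tuple M y) : SaturatedOver (A ∪ c.coords) := by
  rcases finite_or_infinite (Σ s, M s) with h | h
  · exact saturatedOver_of_finite _
  · have hc : c.coords.Finite := Set.finite_range _
    refine hM _ ((mk_union_le _ _).trans_lt (add_lt_of_lt (aleph0_le_mk _) hA ?_))
    exact (lt_aleph0_iff_set_finite.2 hc).trans_le (aleph0_le_mk _)

theorem Saturated.saturatedOver (hM : Saturated M) (hA : Small A) : SaturatedOver A :=
  hM A hA

theorem SaturatedOver.exists_of_directed (hB : SaturatedOver B) [Finite β]
    {F : Set (Tuple M y → Prop)} (hne : F.Nonempty) (hdef : ∀ P ∈ F, DefPred B P)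
    (hdir : ∀ P ∈ F, ∀ Q ∈ F, ∃ R ∈ F, ∀ a, R a → P a ∧ Q a) (hsat : ∀ P ∈ F, ∃ a, P a) :
    ∃ a, ∀ P ∈ F, P a := by
  obtain ⟨a, ha⟩ := hB β y {φ | ∃ P ∈ F, ∀ a, φ.Realize a ↔ P a} (by
    intro G hG hfin
    have : ∃ P ∈ F, ∀ φ ∈ G, ∀ a, P a → φ.Realize a := by
      induction G, hfin using Set.Finite.induction_on with
      | empty => exact ⟨_, hne.some_mem, by simp⟩
      | insert _ _ ih =>
        obtain ⟨P, hP, h⟩ := ih fun φ hφ => hG (Set.mem_insert_of_mem _ hφ)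
        obtain ⟨Q, hQ, h'⟩ := hG (Set.mem_insert _ _)
        obtain ⟨R, hR, h''⟩ := hdir P hP Q hQ
        refine ⟨R, hR, ?_⟩
        rintro φ (rfl | hφ) a ha
        · exact (h' a).2 (h'' a ha).2
        · exact h φ hφ a (h'' a ha).1
    obtain ⟨P, hP, h⟩ := this
    obtain ⟨a, ha⟩ := hsat P hP
    exact ⟨a, fun φ hφ => h φ hφ a ha⟩)
  refine ⟨a, fun P hP => ?_⟩
  obtain ⟨φ, hφ⟩ := hdef P hP
  exact (hφ a).1 (ha φ ⟨P, hP, hφ⟩)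

theorem defPred_iff_of_tp_eq {a a' : Tuple M x} (h : tp A a = tp A a') {P : Tuple M x → Prop}
    (hP : DefPred A P) : P a ↔ P a' := by
  obtain ⟨φ, hφ⟩ := hP
  rw [← hφ, ← hφ]
  exact Set.ext_iff.1 h φ

theorem tp_eq_of_imp {a a' : Tuple M x} (h : ∀ P, DefPred A P → P a → P a') :
    tp A a = tp A a' := by
  ext φ
  exact ⟨h _ φ.defPred, fun h' => by_contra fun hn => h _ φ.defPred.not hn h'⟩

theorem defRel_iff_of_tp_eq {a a' : Tuple M x} {b b' : Tuple M y}
    (h : tp A (a.pair b) = tp A (a'.pair b')) {R : Tuple M x → Tuple M y → Prop}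
    (hR : DefRel A R) : R a b ↔ R a' b' :=
  defPred_iff_of_tp_eq h hR

theorem tp_map_eq {a a' : Tuple M x} (h : tp A a = tp A a') {ρ : Tuple M x → Tuple M y}
    (hρ : TermMap A ρ) : tp A (ρ a) = tp A (ρ a') :=
  tp_eq_of_imp fun _ hP => (defPred_iff_of_tp_eq h (hP.comp subset_rfl hρ)).1

/-- Homogeneity: each A-definable `R` with `R a b` gives a property of a in its type over A, namely
that some tuple is R-related to it, so the conditions on b' are finitely satisfiable. -/
theorem exists_tp_pair_eq {n : ℕ} {y : Fin n → L.Sorts} {a a' : Tuple M x}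
    (hB : SaturatedOver (A ∪ a'.coords)) (h : tp A a = tp A a') (b : Tuple M y) :
    ∃ b' : Tuple M y, tp A (a.pair b) = tp A (a'.pair b') := by
  obtain ⟨b', hb'⟩ := hB.exists_of_directed
    (F := {Q : Tuple M y → Prop | ∃ R : Tuple M x → Tuple M y → Prop,
      DefRel A R ∧ R a b ∧ Q = R a'})
    ⟨_, fun _ _ => ¬ False, DefPred.false.not, not_false, rfl⟩
    (by
      rintro _ ⟨R, hR, -, rfl⟩
      exact hR.comp Set.subset_union_left (.const Set.subset_union_right) .id)
    (by
      rintro _ ⟨R, hR, h₁, rfl⟩ _ ⟨R', hR', h₂, rfl⟩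
      exact ⟨_, ⟨fun a b => R a b ∧ R' a b, DefPred.and hR hR', ⟨h₁, h₂⟩, rfl⟩, fun _ h => h⟩)
    (by
      rintro _ ⟨R, hR, h₁, rfl⟩
      exact (defPred_iff_of_tp_eq h hR.exists_snd).1 ⟨b, h₁⟩)
  refine ⟨b', tp_eq_of_imp fun P hP hab => ?_⟩
  refine hb' _ ⟨fun a b => P (a.pair b), hP.congr fun t => ?_, hab, rfl⟩
  change _ ↔ P (Tuple.pair (M := M) t.fst t.snd)
  rw [Tuple.pair_fst_snd]

/-! ### Loci of complete types -/

namespace CompleteType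

theorem realize_iff (p : CompleteType A x) {a : Tuple M x} (ha : a ∈ p.locus) (φ : Formula A x) :
    φ.Realize a ↔ φ ∈ p.formulas :=
  ⟨fun h => (p.complete φ).resolve_right fun hn => ha _ hn h, ha φ⟩

theorem tp_eq (p : CompleteType A x) {a a' : Tuple M x} (ha : a ∈ p.locus) (ha' : a' ∈ p.locus) :
    tp A a = tp A a' := by
  ext φ
  exact (p.realize_iff ha φ).trans (p.realize_iff ha' φ).symm

theorem mem_locus_of_tp_eq (p : CompleteType A x) {a a' : Tuple M x} (ha : a ∈ p.locus)
    (h : tp A a = tp A a') : a' ∈ p.locus :=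
  fun φ hφ => (Set.ext_iff.1 h φ).1 (ha φ hφ)

theorem defPred_iff (p : CompleteType A x) {a a' : Tuple M x} (ha : a ∈ p.locus)
    (ha' : a' ∈ p.locus) {P : Tuple M x → Prop} (hP : DefPred A P) : P a ↔ P a' :=
  defPred_iff_of_tp_eq (p.tp_eq ha ha') hP

theorem locus_nonempty (p : CompleteType A x) [Finite α] (hA : SaturatedOver A) :
    p.locus.Nonempty :=
  hA α x p.formulas p.finSat

/-- `θ` is an `A`-definable predicate that holds on `p(M)`. -/
def Nbhd (p : CompleteType A x) (θ : Tuple M x → Prop) : Prop :=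
  DefPred A θ ∧ ∀ a ∈ p.locus, θ a

theorem Nbhd.and {p : CompleteType A x} {θ θ' : Tuple M x → Prop} (h : p.Nbhd θ)
    (h' : p.Nbhd θ') : p.Nbhd fun a => θ a ∧ θ' a :=
  ⟨h.1.and h'.1, fun a ha => ⟨h.2 a ha, h'.2 a ha⟩⟩

theorem nbhd_true (p : CompleteType A x) : p.Nbhd fun _ => ¬ False :=
  ⟨DefPred.false.not, fun _ _ => not_false⟩

theorem mem_locus_iff (p : CompleteType A x) {a : Tuple M x} :
    a ∈ p.locus ↔ ∀ θ, p.Nbhd θ → θ a :=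
  ⟨fun ha _ hθ => hθ.2 a ha, fun h φ hφ => h _ ⟨φ.defPred, fun _ ha => ha φ hφ⟩⟩

/-- Compactness: if every neighbourhood admitted a counterexample to `P`, one counterexample would
lie in all of them at once, hence have its components in p(M). The family `f` allows several
realizations of p to be treated simultaneously. -/
theorem exists_nbhd_of_forall (p : CompleteType A x) (hB : SaturatedOver B) (hAB : A ⊆ B)
    [Finite β] {ι : Type} [Finite ι] {f : ι → Tuple M y → Tuple M x} (hf : ∀ k, TermMap B (f k))
    {P : Tuple M y → Prop} (hP : DefPred B P) (h : ∀ t, (∀ k, f k t ∈ p.locus) → P t) :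
    ∃ θ, p.Nbhd θ ∧ ∀ t, (∀ k, θ (f k t)) → P t := by
  by_contra! hn
  obtain ⟨t, ht⟩ := hB.exists_of_directed
    (F := {Q : Tuple M y → Prop | ∃ θ, p.Nbhd θ ∧ Q = fun t => (∀ k, θ (f k t)) ∧ ¬ P t})
    ⟨_, _, p.nbhd_true, rfl⟩
    (by
      rintro _ ⟨θ, hθ, rfl⟩
      refine DefPred.and ?_ hP.not
      exact (DefPred.forall_mem_finite (F := (Set.univ : Set ι)) Set.finite_univ
        fun k _ => hθ.1.comp hAB (hf k)).congr fun b => by simp)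
    (by
      rintro _ ⟨θ, hθ, rfl⟩ _ ⟨θ', hθ', rfl⟩
      exact ⟨_, ⟨_, hθ.and hθ', rfl⟩, fun t ht =>
        ⟨⟨fun k => (ht.1 k).1, ht.2⟩, fun k => (ht.1 k).2, ht.2⟩⟩)
    (by
      rintro _ ⟨θ, hθ, rfl⟩
      exact hn θ hθ)
  refine (ht _ ⟨_, p.nbhd_true, rfl⟩).2 (h t fun k => p.mem_locus_iff.2 fun θ hθ => ?_)
  exact (ht _ ⟨θ, hθ, rfl⟩).1 k

theorem exists_nbhd_of_forall_mem (p : CompleteType A x) [Finite α] (hB : SaturatedOver B)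
    (hAB : A ⊆ B) {P : Tuple M x → Prop} (hP : DefPred B P) (h : ∀ a ∈ p.locus, P a) :
    ∃ θ, p.Nbhd θ ∧ ∀ a, θ a → P a := by
  obtain ⟨θ, hθ, h'⟩ := p.exists_nbhd_of_forall hB hAB (ι := Unit) (f := fun _ t => t)
    (fun _ => .id) hP fun t ht => h t (ht ())
  exact ⟨θ, hθ, fun a ha => h' a fun _ => ha⟩

/-- Here b' stands for the image of b under an automorphism over A taking a to a'. -/
theorem exists_conj {n : ℕ} {y : Fin n → L.Sorts} (p : CompleteType A x) (q : CompleteType A y)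
    {a a' : Tuple M x} (hB : SaturatedOver (A ∪ a'.coords)) (ha : a ∈ p.locus)
    (ha' : a' ∈ p.locus) {b : Tuple M y} (hb : b ∈ q.locus) :
    ∃ b' ∈ q.locus, ∀ R : Tuple M x → Tuple M y → Prop, DefRel A R → (R a b ↔ R a' b') := by
  obtain ⟨b', h⟩ := exists_tp_pair_eq hB (p.tp_eq ha ha') b
  exact ⟨b', q.mem_locus_of_tp_eq hb (tp_map_eq h (TermMap.snd .id)),
    fun R hR => defRel_iff_of_tp_eq h hR⟩

end CompleteType

/-! ### Weak orthogonality in terms of realizations -/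

theorem DefRel.swap {R : Tuple M x → Tuple M y → Prop} (hR : DefRel A R) :
    DefRel A fun b a => R a b :=
  hR.comp subset_rfl (TermMap.snd .id) (TermMap.fst .id)

theorem DefRel.not {R : Tuple M x → Tuple M y → Prop} (hR : DefRel A R) :
    DefRel A fun a b => ¬ R a b :=
  DefPred.not hR

theorem DefRel.exists_fst {n : ℕ} {x : Fin n → L.Sorts} {R : Tuple M x → Tuple M y → Prop}
    (hR : DefRel A R) : DefPred A fun b => ∃ a, R a b :=
  hR.swap.exists_snd

theorem DefRel.forall_fst {n : ℕ} {x : Fin n → L.Sorts} {R : Tuple M x → Tuple M y → Prop}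
    (hR : DefRel A R) : DefPred A fun b => ∀ a, R a b :=
  hR.swap.forall_snd

theorem DefRel.right {R : Tuple M x → Tuple M y → Prop} (hR : DefRel A R) {b : Tuple M y}
    (hAB : A ⊆ B) (hb : b.coords ⊆ B) : DefPred B fun a => R a b :=
  hR.comp hAB .id (.const hb)

theorem DefRel.left {R : Tuple M x → Tuple M y → Prop} (hR : DefRel A R) {a : Tuple M x}
    (hAB : A ⊆ B) (ha : a.coords ⊆ B) : DefPred B fun b => R a b :=
  hR.comp hAB (.const ha) .id

theorem CompleteType.not_weaklyOrthogonal_iff (hM : Saturated M) (hA : Small A) {m n : ℕ}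
    {x : Fin m → L.Sorts} {y : Fin n → L.Sorts} (p : CompleteType A x) (q : CompleteType A y) :
    ¬ p.WeaklyOrthogonal q ↔ ∃ R : Tuple M x → Tuple M y → Prop, DefRel A R ∧
      ∃ b ∈ q.locus, ∃ a ∈ p.locus, ∃ a' ∈ p.locus, R a b ∧ ¬ R a' b := by
  constructor
  · intro h
    by_contra! hn
    refine h fun φ => ?_
    obtain ⟨b, hb⟩ := q.locus_nonempty (hM.saturatedOver hA)
    obtain ⟨a, ha⟩ := p.locus_nonempty (hM.saturatedOver hA)
    have key : ∀ φ : Formula A (Sum.elim x y), φ.Realize (a.pair b) → p.UnionEntails q φ := by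
      intro φ hφ
      have h₁ : ∀ a' ∈ p.locus, φ.Realize (a'.pair b) := fun a' ha' =>
        hn _ φ.defRel b hb a ha a' ha' hφ
      obtain ⟨θ, hθ, h₂⟩ := p.exists_nbhd_of_forall_mem (hM.saturatedOver_union hA b)
        Set.subset_union_left (φ.defRel.right Set.subset_union_left Set.subset_union_right) h₁
      -- Once p(M) is replaced by θ, the statement that φ(x, b) holds throughout is an A-definable
      -- property of b, hence a consequence of q.
      have hdef : DefPred A fun b => ∀ a, θ a → φ.Realize (a.pair b) :=
        DefRel.forall_fst (DefPred.imp (hθ.1.comp subset_rfl (TermMap.fst .id)) φ.defRel)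
      obtain ⟨⟨θ', hθ'⟩, hθ₂⟩ := hθ
      obtain ⟨ψ, hψ⟩ := hdef
      refine ⟨{θ'}, ?_, Set.finite_singleton _, {ψ}, ?_, Set.finite_singleton _, ?_⟩
      · rintro _ rfl
        exact (p.realize_iff ha _).1 ((hθ' a).2 (hθ₂ a ha))
      · rintro _ rfl
        exact (q.realize_iff hb _).1 ((hψ b).2 h₂)
      · intro a' b' ha' hb'
        exact (hψ b').1 (hb' _ rfl) a' ((hθ' a').1 (ha' _ rfl))
    by_cases hφ : φ.Realize (a.pair b)
    · exact Or.inl (key φ hφ)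
    · exact Or.inr (key φ.neg hφ)
  · rintro ⟨R, ⟨φ, hφ⟩, b, hb, a, ha, a', ha', h₁, h₂⟩ h
    rcases h φ with ⟨F, hF, -, G, hG, -, h⟩ | ⟨F, hF, -, G, hG, -, h⟩
    · exact h₂ ((hφ _).1 (h a' b (fun θ hθ => ha' θ (hF hθ)) fun θ hθ => hb θ (hG hθ)))
    · exact h a b (fun θ hθ => ha θ (hF hθ)) (fun θ hθ => hb θ (hG hθ)) ((hφ _).2 h₁)

/-- If b and b' have different types over Aa, moving b' to b takes a to some a' whose type over Ab
differs from that of a. -/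
theorem CompleteType.WeaklyOrthogonal.symm (hM : Saturated M) (hA : Small A) {m n : ℕ}
    {x : Fin m → L.Sorts} {y : Fin n → L.Sorts} {p : CompleteType A x} {q : CompleteType A y}
    (h : p.WeaklyOrthogonal q) : q.WeaklyOrthogonal p := by
  by_contra hn
  obtain ⟨R, hR, a, ha, b, hb, b', hb', h₁, h₂⟩ :=
    (q.not_weaklyOrthogonal_iff hM hA p).1 hn
  obtain ⟨a', ha', h'⟩ := q.exists_conj p (hM.saturatedOver_union hA b) hb' hb ha
  exact (p.not_weaklyOrthogonal_iff hM hA q).2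
    ⟨_, hR.swap, b, hb, a, ha, a', ha', h₁, fun hc => h₂ ((h' R hR).2 hc)⟩ h

/-! ### Stationarily ordered types -/

namespace CompleteType

/-- `P` holds on a non-empty initial part of `p(M)` with respect to `lt`. -/
def Initially (p : CompleteType A x) (lt : Tuple M x → Tuple M x → Prop) (P : Tuple M x → Prop) :
    Prop :=
  ∃ a ∈ p.locus, ∀ a' ∈ p.locus, ¬ lt a a' → P a'

theorem Initially.mono {p : CompleteType A x} {lt : Tuple M x → Tuple M x → Prop}
    {P Q : Tuple M x → Prop} (h : p.Initially lt P) (hPQ : ∀ a ∈ p.locus, P a → Q a) :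
    p.Initially lt Q :=
  h.imp fun _ h => ⟨h.1, fun a' ha' hn => hPQ a' ha' (h.2 a' ha' hn)⟩

/-- The relation `lt`, a strict weak order on the neighbourhood `D` of `p(M)`, witnesses that `p` is
stationarily ordered. -/
structure OrderedBy (p : CompleteType A x) (lt : Tuple M x → Tuple M x → Prop)
    (D : Tuple M x → Prop) : Prop where
  defRel : DefRel A lt
  nbhd : p.Nbhd D
  irrefl : ∀ a, D a → ¬ lt a a
  trans : ∀ a b c, D a → D b → D c → lt a b → lt b c → lt a c
  cotrans : ∀ a b c, D a → D b → D c → lt a c → lt a b ∨ lt b c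
  initially : ∀ P, DefPred Set.univ P → p.Initially lt P ∨ p.Initially lt fun a => ¬ P a
  ultimately : ∀ P, DefPred Set.univ P →
    p.Initially (fun a b => lt b a) P ∨ p.Initially (fun a b => lt b a) fun a => ¬ P a

/-- The axioms of a strict weak order are universal in three variables, so they extend from p(M) to
a neighbourhood by compactness. Incomparability takes the place of equality of tuples. -/
theorem IsSO.exists_orderedBy [Finite α] {p : CompleteType A x} (hA : SaturatedOver A)
    (hp : p.IsSO) : ∃ lt D, p.OrderedBy lt D := by
  obtain ⟨φ, hφ, h⟩ := hp
  have hirr : ∀ a ∈ p.locus, ¬ φ.Realize (a.pair a) := fun a ha => hφ.irrefl ⟨a, ha⟩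
  have htr : ∀ a ∈ p.locus, ∀ b ∈ p.locus, ∀ c ∈ p.locus, φ.Realize (a.pair b) →
      φ.Realize (b.pair c) → φ.Realize (a.pair c) :=
    fun a ha b hb c hc => hφ.trans ⟨a, ha⟩ ⟨b, hb⟩ ⟨c, hc⟩
  have htot : ∀ a ∈ p.locus, ∀ b ∈ p.locus, ¬ φ.Realize (a.pair b) →
      ¬ φ.Realize (b.pair a) → a = b := fun a ha b hb h₁ h₂ =>
    congrArg Subtype.val (hφ.trichotomous ⟨a, ha⟩ ⟨b, hb⟩ h₁ h₂)
  have hco : ∀ a ∈ p.locus, ∀ b ∈ p.locus, ∀ c ∈ p.locus, φ.Realize (a.pair c) →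
      φ.Realize (a.pair b) ∨ φ.Realize (b.pair c) := by
    intro a ha b hb c hc hac
    by_contra! hn
    by_cases hba : φ.Realize (b.pair a)
    · exact hn.2 (htr b hb a ha c hc hba hac)
    · rw [htot a ha b hb hn.1 hba] at hac
      exact hn.2 hac
  obtain ⟨D, hD, h'⟩ := p.exists_nbhd_of_forall hA subset_rfl (ι := Fin 3)
    (y := Sum.elim x (Sum.elim x x)) (f := ![fun t => t.fst, fun t => t.snd.fst, fun t => t.snd.snd])
    (by
      intro k
      fin_cases k
      · exact TermMap.fst .id
      · exact TermMap.fst (TermMap.snd .id)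
      · exact TermMap.snd (TermMap.snd .id))
    (P := fun t => ¬ φ.Realize (t.fst.pair t.fst) ∧
      (φ.Realize (t.fst.pair t.snd.fst) → φ.Realize (t.snd.fst.pair t.snd.snd) →
        φ.Realize (t.fst.pair t.snd.snd)) ∧
      (φ.Realize (t.fst.pair t.snd.snd) →
        φ.Realize (t.fst.pair t.snd.fst) ∨ φ.Realize (t.snd.fst.pair t.snd.snd)))
    (by
      have h₁ : TermMap A fun t : Tuple M (Sum.elim x (Sum.elim x x)) => t.fst := TermMap.fst .id
      have h₂ : TermMap A fun t : Tuple M (Sum.elim x (Sum.elim x x)) => t.snd.fst :=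
        TermMap.fst (TermMap.snd .id)
      have h₃ : TermMap A fun t : Tuple M (Sum.elim x (Sum.elim x x)) => t.snd.snd :=
        TermMap.snd (TermMap.snd .id)
      have hd := φ.defRel
      exact (hd.comp subset_rfl h₁ h₁).not.and
        (((hd.comp subset_rfl h₁ h₂).imp ((hd.comp subset_rfl h₂ h₃).imp
          (hd.comp subset_rfl h₁ h₃))).and
        ((hd.comp subset_rfl h₁ h₃).imp
          ((hd.comp subset_rfl h₁ h₂).or (hd.comp subset_rfl h₂ h₃)))))
    (fun t ht => ⟨hirr _ (ht 0), htr _ (ht 0) _ (ht 1) _ (ht 2),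
      hco _ (ht 0) _ (ht 1) _ (ht 2)⟩)
  have h'' : ∀ a b c, D a → D b → D c → _ := fun a b c ha hb hc =>
    h' (a.pair (b.pair c)) (by
      intro k
      fin_cases k
      · exact ha
      · exact hb
      · exact hc)
  have eventual : ∀ (r : Tuple M x → Tuple M x → Prop) (P : Tuple M x → Prop) (S : Set p.locus),
      (∀ a ∈ p.locus, ∀ b ∈ p.locus, ¬ r a b → r b a ∨ a = b) →
      (∀ a : p.locus, a ∈ S ↔ P a) →
      LeftEventual (fun a b : p.locus => r a b) S → p.Initially r P := by
    rintro r P S hr hS ⟨I, hI, ⟨a, ha⟩, hI'⟩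
    refine ⟨a, a.2, fun b hb hab => (hS ⟨b, hb⟩).1 (hI ?_)⟩
    rcases hr a a.2 b hb hab with hba | rfl
    · exact hI' a ha ⟨b, hb⟩ hba
    · exact ha
  have hr : ∀ a ∈ p.locus, ∀ b ∈ p.locus, ¬ φ.Realize (a.pair b) →
      φ.Realize (b.pair a) ∨ a = b := by
    intro a ha b hb hab
    by_contra! hn
    exact hn.2 (htot a ha b hb hab hn.1)
  refine ⟨fun a b => φ.Realize (a.pair b), D, φ.defRel, hD, fun a ha => (h'' a a a ha ha ha).1,
    fun a b c ha hb hc => (h'' a b c ha hb hc).2.1,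
    fun a b c ha hb hc => (h'' a b c ha hb hc).2.2, ?_, ?_⟩
  · rintro P ⟨ψ, hψ⟩
    -- Only "at least one" is kept from the exclusive or; exclusiveness is automatic, by
    -- `not_initially_not`.
    refine (h ψ).1.or.imp (fun h => eventual _ _ _ hr (fun a => hψ a) h)
      (fun h => eventual _ _ _ hr (fun a => not_congr (hψ a)) h)
  · rintro P ⟨ψ, hψ⟩
    have hr' : ∀ a ∈ p.locus, ∀ b ∈ p.locus, ¬ φ.Realize (b.pair a) →
        φ.Realize (a.pair b) ∨ a = b := fun a ha b hb hab => (hr b hb a ha hab).imp_right Eq.symm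
    exact (h ψ).2.or.imp (fun h => eventual _ _ _ hr' (fun a => hψ a) h)
      (fun h => eventual _ _ _ hr' (fun a => not_congr (hψ a)) h)

namespace OrderedBy

variable {p : CompleteType A x} {lt : Tuple M x → Tuple M x → Prop} {D : Tuple M x → Prop}

/-- Reversing the order turns every result on initial parts into one on final parts. -/
theorem flip (h : p.OrderedBy lt D) : p.OrderedBy (fun a b => lt b a) D where
  defRel := h.defRel.swap
  nbhd := h.nbhd
  irrefl := h.irrefl
  trans a b c ha hb hc h₁ h₂ := h.trans c b a hc hb ha h₂ h₁
  cotrans a b c ha hb hc h₁ := (h.cotrans c b a hc hb ha h₁).symm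
  initially := h.ultimately
  ultimately := h.initially

theorem asymm (h : p.OrderedBy lt D) {a b : Tuple M x} (ha : D a) (hb : D b) (hab : lt a b) :
    ¬ lt b a :=
  fun hba => h.irrefl a ha (h.trans a b a ha hb ha hab hba)

theorem initially_and (h : p.OrderedBy lt D) {P Q : Tuple M x → Prop} (hP : p.Initially lt P)
    (hQ : p.Initially lt Q) : p.Initially lt fun a => P a ∧ Q a := by
  obtain ⟨a, ha, hP⟩ := hP
  obtain ⟨b, hb, hQ⟩ := hQ
  have hD := h.nbhd.2
  by_cases hab : lt a b
  · exact ⟨a, ha, fun c hc hn => ⟨hP c hc hn, hQ c hc fun hbc =>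
      hn (h.trans a b c (hD a ha) (hD b hb) (hD c hc) hab hbc)⟩⟩
  · exact ⟨b, hb, fun c hc hn => ⟨hP c hc fun hac =>
      (h.cotrans a b c (hD a ha) (hD b hb) (hD c hc) hac).elim hab hn, hQ c hc hn⟩⟩

theorem exists_of_initially (h : p.OrderedBy lt D) {P : Tuple M x → Prop}
    (hP : p.Initially lt P) : ∃ a ∈ p.locus, P a := by
  obtain ⟨a, ha, hP⟩ := hP
  exact ⟨a, ha, hP a ha (h.irrefl a (h.nbhd.2 a ha))⟩

theorem not_initially_not (h : p.OrderedBy lt D) {P : Tuple M x → Prop}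
    (hP : p.Initially lt P) : ¬ p.Initially lt fun a => ¬ P a := fun hn => by
  obtain ⟨a, -, h₁, h₂⟩ := h.exists_of_initially (h.initially_and hP hn)
  exact h₂ h₁

theorem exists_initial_cut_of_initially {n : ℕ} {x : Fin n → L.Sorts}
    {p : CompleteType A x} {lt : Tuple M x → Tuple M x → Prop} {D : Tuple M x → Prop}
    (h : p.OrderedBy lt D) (hM : Saturated M) (hA : Small A) [Finite β]
    {b : Tuple M y} {R : Tuple M x → Tuple M y → Prop} (hR : DefRel A R)
    (hb : p.Initially lt fun a => R a b) {a₀ : Tuple M x} (ha₀ : a₀ ∈ p.locus) (hn : ¬ R a₀ b) :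
    ∃ Q : Tuple M x → Tuple M y → Prop, DefRel A Q ∧
      (∀ c a a', D a → D a' → Q a c → ¬ lt a a' → Q a' c) ∧
      (∃ a ∈ p.locus, Q a b) ∧ ∃ a ∈ p.locus, ¬ Q a b := by
  obtain ⟨a, ha, h₁⟩ := hb
  obtain ⟨θ, hθ, h₂⟩ := p.exists_nbhd_of_forall_mem (P := fun a' => ¬ R a' b → lt a a')
    (hM.saturatedOver_union hA (a.pair b)) Set.subset_union_left
    (by
      rw [Tuple.coords_pair]
      exact (hR.right Set.subset_union_left (by tauto_set)).not.imp
        (h.defRel.left Set.subset_union_left (by tauto_set)))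
    (fun a' ha' hn => by_contra fun h' => hn (h₁ a' ha' h'))
  -- The cut consists of the points below every failure of R(x, c) in the neighbourhood; θ was
  -- chosen so that, for c = b, the point a lies in it.
  refine ⟨fun a c => ∀ a', θ a' → D a' → ¬ R a' c → lt a a', ?_, ?_, ⟨a, ha, ?_⟩, a₀, ha₀, ?_⟩
  · refine DefRel.forall_snd (R := fun (t : Tuple M (Sum.elim x y)) a' =>
      θ a' → D a' → ¬ R a' t.snd → lt t.fst a') ?_
    exact DefPred.imp (hθ.1.comp subset_rfl (TermMap.snd .id)) (DefPred.imp
      (h.nbhd.1.comp subset_rfl (TermMap.snd .id)) (DefPred.imp (DefPred.not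
      (hR.comp subset_rfl (TermMap.snd .id) (TermMap.snd (TermMap.fst .id))))
      (h.defRel.comp subset_rfl (TermMap.fst (TermMap.fst .id)) (TermMap.snd .id))))
  · intro c a a' hDa hDa' hQ hlt a'' h₃ h₄ h₅
    exact (h.cotrans a a' a'' hDa hDa' h₄ (hQ a'' h₃ h₄ h₅)).resolve_left hlt
  · exact fun a' h₃ _ h₄ => h₂ a' h₃ h₄
  · exact fun h' => h.irrefl a₀ (h.nbhd.2 _ ha₀) (h' a₀ (hθ.2 _ ha₀) (h.nbhd.2 _ ha₀) hn)

theorem exists_initial_cut {n : ℕ} {x : Fin n → L.Sorts}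
    {p : CompleteType A x} {lt : Tuple M x → Tuple M x → Prop} {D : Tuple M x → Prop}
    (h : p.OrderedBy lt D) (hM : Saturated M) (hA : Small A) [Finite β]
    {b : Tuple M y} {R : Tuple M x → Tuple M y → Prop} (hR : DefRel A R)
    {a₀ a₁ : Tuple M x} (ha₀ : a₀ ∈ p.locus) (ha₁ : a₁ ∈ p.locus) (h₀ : R a₀ b) (h₁ : ¬ R a₁ b) :
    ∃ Q : Tuple M x → Tuple M y → Prop, DefRel A Q ∧
      (∀ c a a', D a → D a' → Q a c → ¬ lt a a' → Q a' c) ∧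
      (∃ a ∈ p.locus, Q a b) ∧ ∃ a ∈ p.locus, ¬ Q a b := by
  rcases h.initially _ (hR.right (b := b) (Set.subset_univ _) (Set.subset_univ _)) with hi | hi
  · exact h.exists_initial_cut_of_initially hM hA hR hi ha₁ h₁
  · exact h.exists_initial_cut_of_initially hM hA hR.not hi ha₀ (not_not.2 h₀)

end OrderedBy

/-- Both b and c cut p(M), and comparing the two cuts by inclusion relates q to r. -/
theorem not_weaklyOrthogonal_trans (hM : Saturated M) (hA : Small A) {m n k : ℕ}
    {x : Fin m → L.Sorts} {y : Fin n → L.Sorts} {z : Fin k → L.Sorts} {p : CompleteType A x}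
    {q : CompleteType A y} {r : CompleteType A z} (hp : p.IsSO) (hpq : ¬ p.WeaklyOrthogonal q)
    (hpr : ¬ p.WeaklyOrthogonal r) : ¬ q.WeaklyOrthogonal r := by
  obtain ⟨lt, D, h⟩ := hp.exists_orderedBy (hM.saturatedOver hA)
  obtain ⟨R, hR, b, hb, a, ha, a', ha', h₁, h₂⟩ := (p.not_weaklyOrthogonal_iff hM hA q).1 hpq
  obtain ⟨Q, hQ, hQi, ⟨a₀, ha₀, hQ₀⟩, a₁, ha₁, hQ₁⟩ :=
    h.exists_initial_cut hM hA hR ha ha' h₁ h₂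
  obtain ⟨R', hR', c, hc, d, hd, d', hd', h₁', h₂'⟩ :=
    (p.not_weaklyOrthogonal_iff hM hA r).1 hpr
  obtain ⟨S, hS, hSi, ⟨d₀, hd₀, hS₀⟩, d₁, hd₁, hS₁⟩ :=
    h.exists_initial_cut hM hA hR' hd hd' h₁' h₂'
  -- The cut of b₀ omits d₀, which is in the cut of c; the cut of b₁ contains d₁, which is not, and
  -- so it includes the cut of c.
  obtain ⟨b₀, hb₀, hb₀'⟩ := p.exists_conj q (hM.saturatedOver_union hA d₀) ha₁ hd₀ hb
  obtain ⟨b₁, hb₁, hb₁'⟩ := p.exists_conj q (hM.saturatedOver_union hA d₁) ha₀ hd₁ hb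
  refine (q.not_weaklyOrthogonal_iff hM hA r).2
    ⟨fun b c => ∃ a, D a ∧ S a c ∧ ¬ Q a b, ?_, c, hc, b₀, hb₀, b₁, hb₁, ?_, ?_⟩
  · refine DefRel.exists_snd (R := fun (t : Tuple M (Sum.elim y z)) a =>
      D a ∧ S a t.snd ∧ ¬ Q a t.fst) ?_
    exact DefPred.and (h.nbhd.1.comp subset_rfl (TermMap.snd .id)) (DefPred.and
      (hS.comp subset_rfl (TermMap.snd .id) (TermMap.snd (TermMap.fst .id)))
      (DefPred.not (hQ.comp subset_rfl (TermMap.snd .id) (TermMap.fst (TermMap.fst .id)))))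
  · exact ⟨d₀, h.nbhd.2 _ hd₀, hS₀, fun hQ' => hQ₁ ((hb₀' Q hQ).2 hQ')⟩
  · rintro ⟨e, hDe, hSe, hQe⟩
    have hDd := h.nbhd.2 _ hd₁
    by_cases hlt : lt e d₁
    · exact hQe (hQi b₁ d₁ e hDd hDe ((hb₁' Q hQ).1 hQ₀) (h.asymm hDe hDd hlt))
    · exact hS₁ (hSi c e d₁ hDe hDd hSe hlt)

end CompleteType

/-! ### Forking and stationarily ordered types -/

/-- Two finite tuples of variables can be merged into one. -/
theorem DefRel.exists_append {l k : ℕ} {z : Fin l → L.Sorts} {u : Fin k → L.Sorts}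
    {S : Tuple M (Sum.elim x z) → Tuple M u → Prop} (hS : DefRel B S) :
    ∃ (w : Fin (l + k) → L.Sorts) (E : Tuple M z → Tuple M u → Tuple M w),
      (∀ (A : Set (Σ s, M s)) (d : Tuple M u), d.coords ⊆ A → TermMap A fun c => E c d) ∧
      ∃ φ : Formula B (Sum.elim x w), ∀ (a : Tuple M x) (c : Tuple M z) (d : Tuple M u),
        φ.Realize (a.pair (E c d)) ↔ S (a.pair c) d := by
  let w : Fin (l + k) → L.Sorts := fun i => Sum.elim z u (finSumFinEquiv.symm i)
  let E : Tuple M z → Tuple M u → Tuple M w := fun c d i => (c.pair d) (finSumFinEquiv.symm i)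
  -- Stated with a free index j so that substituting the equation replaces any cast between sorts.
  have hvar : ∀ j i, finSumFinEquiv.symm i = j → ∃ t : Term B (Sum.elim x w) (Sum.elim z u j),
      ∀ (a : Tuple M x) c d, t.eval (a.pair (E c d)) = (c.pair d) j := by
    rintro _ i rfl
    exact ⟨.var (x := Sum.elim x w) (Sum.inr i), fun _ _ _ => rfl⟩
  have hterm : ∀ i, ∃ t : Term B (Sum.elim x w) (Sum.elim (Sum.elim x z) u i),
      ∀ (a : Tuple M x) c d, t.eval (a.pair (E c d)) = ((a.pair c).pair d) i := by
    rintro ((i | j) | j)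
    · exact ⟨.var (x := Sum.elim x w) (Sum.inl i), fun _ _ _ => rfl⟩
    · exact hvar (Sum.inl j) _ (Equiv.symm_apply_apply _ _)
    · exact hvar (Sum.inr j) _ (Equiv.symm_apply_apply _ _)
  choose t ht using hterm
  obtain ⟨φ, hφ⟩ := DefPred.comp hS subset_rfl
    (ρ := fun (b : Tuple M (Sum.elim x w)) i => (t i).eval b) fun i => ⟨t i, fun _ => rfl⟩
  refine ⟨w, E, fun A d hd i => TermMap.pair .id (.const hd) _, φ, fun a c d => ?_⟩
  have e : (fun i => (t i).eval (a.pair (E c d))) = (a.pair c).pair d :=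
    funext fun i => ht i a c d
  rw [hφ]
  beta_reduce
  rw [e]
  rfl

/-- Pairwise disjoint conjugates are 2-inconsistent. Dividing is defined for parameter-free
formulas, so the parameters d of R from A are appended to c and stay constant along the sequence. -/
theorem forks_of_sequence {m l : ℕ} {x : Fin m → L.Sorts} {z : Fin l → L.Sorts}
    {R : Tuple M x → Tuple M z → Prop} (hR : DefRel A R) {a : Tuple M x} {c : Tuple M z}
    (hac : R a c) (s : ℕ → Tuple M z) (hs : ∀ i, tp A (s i) = tp A c)
    (hdisj : ∀ i j, i < j → ∀ a, R a (s i) → ¬ R a (s j)) :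
    Forks A (tp (A ∪ c.coords) a) := by
  obtain ⟨k, u, d, hd, S, hS, hSR⟩ := DefPred.exists_tuple hR
  obtain ⟨w, E, hE, φ, hφ⟩ := hS.exists_append
  have hφR : ∀ a c, φ.Realize (a.pair (E c d)) ↔ R a c := fun a c =>
    (hφ a c d).trans (hSR (a.pair c))
  obtain ⟨ψ, hψ⟩ := hR.right (b := c) (B := A ∪ c.coords) Set.subset_union_left
    Set.subset_union_right
  refine ⟨1, fun _ => l + k, fun _ => w, fun _ => φ, fun _ => E c d, fun _ => ?_, {ψ}, ?_,
    Set.finite_singleton _, fun a' ha' => ⟨0, (hφR _ _).2 ((hψ a').1 (ha' _ rfl))⟩⟩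
  · refine ⟨fun i => E (s i) d, fun i => tp_map_eq (hs i) (hE A d hd), 2, two_pos, ?_⟩
    rintro I hI ⟨a', ha'⟩
    obtain ⟨i, j, hij, rfl⟩ := Finset.card_eq_two.1 hI
    have hi := (hφR _ _).1 (ha' i (by simp))
    have hj := (hφR _ _).1 (ha' j (by simp))
    rcases lt_or_gt_of_ne hij with h | h
    · exact hdisj i j h a' hi hj
    · exact hdisj j i h a' hj hi
  · rintro _ rfl
    exact (hψ a).2 hac

namespace CompleteType

namespace OrderedBy

variable {p : CompleteType A x} {lt : Tuple M x → Tuple M x → Prop} {D : Tuple M x → Prop}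

theorem initially_forall_mem (h : p.OrderedBy lt D) (hne : p.locus.Nonempty) {ι : Type*}
    (I : Finset ι) {P : ι → Tuple M x → Prop} (hP : ∀ i ∈ I, p.Initially lt (P i)) :
    p.Initially lt fun a => ∀ i ∈ I, P i a := by
  classical
  induction I using Finset.induction_on with
  | empty => exact ⟨_, hne.some_mem, by simp⟩
  | insert i I _ ih =>
    refine (h.initially_and (hP i (Finset.mem_insert_self _ _))
      (ih fun j hj => hP j (Finset.mem_insert_of_mem hj))).mono fun a _ ha => ?_
    rw [Finset.forall_mem_insert]
    exact ha

/-- Truth on an initial part passes to every conjugate of b, and any k initial parts share a point,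
against k-inconsistency. -/
theorem not_initially_of_divides {m n : ℕ} {x : Fin m → L.Sorts} {y : Fin n → L.Sorts}
    {p : CompleteType A x} {lt : Tuple M x → Tuple M x → Prop} {D : Tuple M x → Prop}
    (h : p.OrderedBy lt D) (hM : Saturated M) (hA : Small A)
    {φ : Formula (∅ : Set (Σ s, M s)) (Sum.elim x y)} {b : Tuple M y} (hb : Divides A φ b) :
    ¬ p.Initially lt fun a => φ.Realize (a.pair b) := by
  rintro ⟨a, ha, h₁⟩
  obtain ⟨c, hc, k, -, hk⟩ := hb
  obtain ⟨θ, hθ, h₂⟩ := p.exists_nbhd_of_forall_mem (hM.saturatedOver_union hA (a.pair b))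
    Set.subset_union_left (P := fun a' => ¬ lt a a' → φ.Realize (a'.pair b))
    (by
      rw [Tuple.coords_pair]
      exact (h.defRel.left Set.subset_union_left (by tauto_set)).not.imp
        (φ.defRel.right (Set.empty_subset _) (by tauto_set)))
    h₁
  have hT : DefRel A fun b a => ∀ a', θ a' → ¬ lt a a' → φ.Realize (a'.pair b) := by
    refine DefRel.forall_snd (R := fun (t : Tuple M (Sum.elim y x)) a' =>
      θ a' → ¬ lt t.snd a' → φ.Realize (a'.pair t.fst)) ?_
    exact DefPred.imp (hθ.1.comp subset_rfl (TermMap.snd .id)) (DefPred.imp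
      (h.defRel.comp subset_rfl (TermMap.snd (TermMap.fst .id)) (TermMap.snd .id)).not
      (φ.defRel.comp (Set.empty_subset _) (TermMap.snd .id) (TermMap.fst (TermMap.fst .id))))
  have hi : ∀ i, p.Initially lt fun a => φ.Realize (a.pair (c i)) := fun i => by
    obtain ⟨a', ha'⟩ := exists_tp_pair_eq (hM.saturatedOver_union hA (c i)) (hc i).symm a
    refine ⟨a', p.mem_locus_of_tp_eq ha (tp_map_eq ha' (TermMap.snd .id)), fun a'' h₃ h₄ => ?_⟩
    exact (defRel_iff_of_tp_eq ha' hT).1 (fun a' ha' => h₂ a' ha') a'' (hθ.2 _ h₃) h₄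
  obtain ⟨a', -, ha'⟩ := h.exists_of_initially
    (h.initially_forall_mem ⟨a, ha⟩ (Finset.range k) fun i _ => hi i)
  exact hk _ (Finset.card_range k) ⟨a', ha'⟩

theorem not_initially_of_forall_exists {m : ℕ} {x : Fin m → L.Sorts}
    {p : CompleteType A x} {lt : Tuple M x → Tuple M x → Prop} {D : Tuple M x → Prop}
    (h : p.OrderedBy lt D) (hM : Saturated M) (hA : Small A) {N : ℕ} {len : Fin N → ℕ}
    {y : ∀ j, Fin (len j) → L.Sorts}
    {φ : ∀ j, Formula (∅ : Set (Σ s, M s)) (Sum.elim x (y j))} {b : ∀ j, Tuple M (y j)}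
    (hb : ∀ j, Divides A (φ j) (b j)) {P : Tuple M x → Prop}
    (hP : ∀ a, P a → ∃ j, (φ j).Realize (a.pair (b j))) : ¬ p.Initially lt P := by
  intro hi
  have hn : ∀ j, p.Initially lt fun a => ¬ (φ j).Realize (a.pair (b j)) := fun j =>
    (h.initially _ ((φ j).defRel.right (Set.empty_subset _) (Set.subset_univ _))).resolve_left
      (h.not_initially_of_divides hM hA (hb j))
  obtain ⟨a, -, h₁, h₂⟩ := h.exists_of_initially (h.initially_and hi
    (h.initially_forall_mem (p.locus_nonempty (hM.saturatedOver hA)) Finset.univ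
      fun j _ => hn j))
  obtain ⟨j, hj⟩ := hP a h₁
  exact h₂ j (Finset.mem_univ _) hj

/-- By stationarity, R(x, c) fails near both ends of p(M); intersecting with a neighbourhood makes
the bounds hold in all of M and not only in p(M). -/
theorem exists_bound {m : ℕ} {x : Fin m → L.Sorts}
    {p : CompleteType A x} {lt : Tuple M x → Tuple M x → Prop} {D : Tuple M x → Prop}
    (h : p.OrderedBy lt D) (hM : Saturated M) (hA : Small A) [Finite γ]
    {R : Tuple M x → Tuple M z → Prop} (hR : DefRel A R) {c : Tuple M z}
    (h₁ : ¬ p.Initially lt fun a => R a c)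
    (h₂ : ¬ p.Initially (fun a b => lt b a) fun a => R a c) :
    ∃ R' : Tuple M x → Tuple M z → Prop, DefRel A R' ∧ (∀ a c, R' a c → D a) ∧
      (∀ a ∈ p.locus, R a c → R' a c) ∧ ∃ a₀ ∈ p.locus, ∃ a₁ ∈ p.locus,
        ∀ a, R' a c → lt a₀ a ∧ lt a a₁ := by
  have hu : DefPred Set.univ fun a => R a c :=
    hR.right (Set.subset_univ _) (Set.subset_univ _)
  obtain ⟨a₀, ha₀, h₃⟩ := (h.initially _ hu).resolve_left h₁
  obtain ⟨a₁, ha₁, h₄⟩ := (h.ultimately _ hu).resolve_left h₂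
  obtain ⟨θ, hθ, h₅⟩ := p.exists_nbhd_of_forall_mem
    (hM.saturatedOver_union hA (c.pair (a₀.pair a₁))) Set.subset_union_left
    (P := fun a => R a c → lt a₀ a ∧ lt a a₁)
    (by
      rw [Tuple.coords_pair, Tuple.coords_pair]
      exact (hR.right Set.subset_union_left (by tauto_set)).imp
        ((h.defRel.left Set.subset_union_left (by tauto_set)).and
          (h.defRel.right Set.subset_union_left (by tauto_set))))
    (fun a ha hac => ⟨by_contra fun hn => h₃ a ha hn hac, by_contra fun hn => h₄ a ha hn hac⟩)
  refine ⟨fun a c => θ a ∧ D a ∧ R a c, ?_, fun a c ha => ha.2.1,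
    fun a ha hac => ⟨hθ.2 a ha, h.nbhd.2 a ha, hac⟩, a₀, ha₀, a₁, ha₁,
    fun a ha => h₅ a ha.1 ha.2.2⟩
  exact DefPred.and (hθ.1.comp subset_rfl (TermMap.fst .id))
    (DefPred.and (h.nbhd.1.comp subset_rfl (TermMap.fst .id)) hR)

/-- If `tp(a/Ac)` forks over `A` then it contains a formula with bounded trace on `p(M)`. -/
theorem exists_bound_of_forks {m : ℕ} {x : Fin m → L.Sorts}
    {p : CompleteType A x} {lt : Tuple M x → Tuple M x → Prop} {D : Tuple M x → Prop}
    (h : p.OrderedBy lt D) (hM : Saturated M) (hA : Small A) [Finite γ]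
    {a : Tuple M x} {c : Tuple M z} (ha : a ∈ p.locus) (hf : Forks A (tp (A ∪ c.coords) a)) :
    ∃ R : Tuple M x → Tuple M z → Prop, DefRel A R ∧ (∀ a c, R a c → D a) ∧ R a c ∧
      ∃ a₀ ∈ p.locus, ∃ a₁ ∈ p.locus, ∀ a, R a c → lt a₀ a ∧ lt a a₁ := by
  obtain ⟨N, len, y, φ, b, hb, F, hF, hfin, hFφ⟩ := hf
  obtain ⟨R, hR, hRF⟩ := DefPred.exists_defRel (A := A) (c := c)
    (DefPred.forall_mem_finite hfin fun θ _ => Formula.defPred θ)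
  have hRφ : ∀ a, R a c → ∃ j, (φ j).Realize (a.pair (b j)) := fun a ha => hFφ a ((hRF a).1 ha)
  obtain ⟨R', hR', hD, hRR', hbound⟩ := h.exists_bound hM hA hR
    (h.not_initially_of_forall_exists hM hA hb hRφ)
    (h.flip.not_initially_of_forall_exists hM hA hb hRφ)
  exact ⟨R', hR', hD, hRR' a ha ((hRF a).2 fun θ hθ => hF hθ), hbound⟩

/-- A type over `Ac` containing a formula with bounded trace on `p(M)` forks over `A`. -/
theorem forks_of_bound {m l : ℕ} {x : Fin m → L.Sorts} {z : Fin l → L.Sorts}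
    {p : CompleteType A x} {lt : Tuple M x → Tuple M x → Prop} {D : Tuple M x → Prop}
    (h : p.OrderedBy lt D) (hM : Saturated M) (hA : Small A)
    {R : Tuple M x → Tuple M z → Prop} (hR : DefRel A R) (hD : ∀ a c, R a c → D a)
    {a : Tuple M x} {c : Tuple M z} (hac : R a c) {a₀ a₁ : Tuple M x} (ha₀ : a₀ ∈ p.locus)
    (ha₁ : a₁ ∈ p.locus) (hb : ∀ a, R a c → lt a₀ a ∧ lt a a₁) :
    Forks A (tp (A ∪ c.coords) a) := by
  have hDp := h.nbhd.2
  have hlt : lt a₀ a₁ :=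
    h.trans _ _ _ (hDp _ ha₀) (hD _ _ hac) (hDp _ ha₁) (hb a hac).1 (hb a hac).2
  have hbound : DefRel A fun (t : Tuple M (Sum.elim x z)) (e' : Tuple M x) =>
      ∀ a, R a t.snd → lt t.fst a ∧ lt a e' := by
    refine DefRel.forall_snd (R := fun (t : Tuple M (Sum.elim (Sum.elim x z) x)) a =>
      R a t.fst.snd → lt t.fst.fst a ∧ lt a t.snd) ?_
    exact DefPred.imp (hR.comp subset_rfl (TermMap.snd .id) (TermMap.snd (TermMap.fst
      (TermMap.fst .id)))) (DefPred.and
      (h.defRel.comp subset_rfl (TermMap.fst (TermMap.fst (TermMap.fst .id))) (TermMap.snd .id))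
      (h.defRel.comp subset_rfl (TermMap.snd .id) (TermMap.snd (TermMap.fst .id))))
  -- Translate the configuration (a₀, c, a₁) over A so that it starts at e. Iterating, each
  -- translate starts where the previous one ended.
  have step : ∀ e : p.locus, ∃ (c' : Tuple M z) (e' : p.locus), tp A c' = tp A c ∧
      lt e.1 e'.1 ∧ ∀ a, R a c' → lt e.1 a ∧ lt a e'.1 := by
    rintro ⟨e, he⟩
    obtain ⟨c', hc'⟩ := exists_tp_pair_eq (hM.saturatedOver_union hA e) (p.tp_eq ha₀ he) c
    obtain ⟨e', he'⟩ := exists_tp_pair_eq (hM.saturatedOver_union hA (e.pair c')) hc' a₁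
    refine ⟨c', ⟨e', p.mem_locus_of_tp_eq ha₁ (tp_map_eq he' (TermMap.snd .id))⟩,
      (tp_map_eq hc' (TermMap.snd .id)).symm, ?_, ?_⟩
    · exact (defRel_iff_of_tp_eq he' (R := fun (t : Tuple M (Sum.elim x z)) e' => lt t.fst e')
        (h.defRel.comp subset_rfl (TermMap.fst (TermMap.fst .id)) (TermMap.snd .id))).1 hlt
    · exact (defRel_iff_of_tp_eq he' hbound).1 hb
  choose nextc nexte htp hlt' hbd using step
  let e : ℕ → p.locus := fun i => Nat.rec ⟨a₀, ha₀⟩ (fun _ e => nexte e) i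
  have hDe : ∀ i, D (e i).1 := fun i => hDp _ (e i).2
  refine forks_of_sequence hR hac (fun i => nextc (e i)) (fun i => htp (e i)) ?_
  intro i j hij a' hi hj
  have hDa := hD _ _ hi
  have : ∀ j, i + 1 ≤ j → lt a' (e j).1 := by
    intro j hij
    induction j, hij using Nat.le_induction with
    | base => exact (hbd (e i) a' hi).2
    | succ j _ ih => exact h.trans _ _ _ hDa (hDe j) (hDe (j + 1)) ih (hlt' (e j))
  exact h.asymm hDa (hDe j) (this j hij) (hbd (e j) a' hj).1

/-- A nested `A`-definable family of non-empty subsets of `q(M)`, indexed by the realizations of a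
complete type over `A`, has no bounded members. -/
theorem not_bounded_of_nested {m n : ℕ} {x : Fin m → L.Sorts} {y : Fin n → L.Sorts}
    (p : CompleteType A x) {q : CompleteType A y} {lt : Tuple M y → Tuple M y → Prop}
    {D : Tuple M y → Prop} (h : q.OrderedBy lt D) (hM : Saturated M) (hA : Small A)
    {H : Tuple M x → Tuple M y → Prop} (hH : DefRel A H)
    (hnest : ∀ a ∈ p.locus, ∀ a' ∈ p.locus,
      (∀ b ∈ q.locus, H a b → H a' b) ∨ ∀ b ∈ q.locus, H a' b → H a b)
    (hne : ∃ a ∈ p.locus, ∃ b ∈ q.locus, H a b) {a : Tuple M x} (ha : a ∈ p.locus)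
    (h₁ : q.Initially lt fun b => ¬ H a b) :
    ¬ q.Initially (fun b c => lt c b) fun b => ¬ H a b := by
  rintro ⟨b₁, hb₁, h₂⟩
  obtain ⟨b₀, hb₀, h₁⟩ := h₁
  have hne' : ∀ a' ∈ p.locus, ∃ b ∈ q.locus, H a' b := by
    intro a' ha'
    obtain ⟨a, ha, b, hb, hab⟩ := hne
    obtain ⟨b', hb', hR⟩ := p.exists_conj q (hM.saturatedOver_union hA a') ha ha' hb
    exact ⟨b', hb', (hR H hH).1 hab⟩
  obtain ⟨θ, hθ, h₃⟩ := q.exists_nbhd_of_forall_mem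
    (hM.saturatedOver_union hA (a.pair b₀)) Set.subset_union_left
    (P := fun b => H a b → lt b₀ b)
    (by
      rw [Tuple.coords_pair]
      exact (hH.left Set.subset_union_left (by tauto_set)).imp
        (h.defRel.left Set.subset_union_left (by tauto_set)))
    (fun b hb hab => by_contra fun hn => h₁ b hb hn hab)
  have hT : DefRel A fun b₀ a => ∀ b, θ b → H a b → lt b₀ b := by
    refine DefRel.forall_snd (R := fun (t : Tuple M (Sum.elim y x)) b =>
      θ b → H t.snd b → lt t.fst b) ?_
    exact DefPred.imp (hθ.1.comp subset_rfl (TermMap.snd .id)) (DefPred.imp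
      (hH.comp subset_rfl (TermMap.snd (TermMap.fst .id)) (TermMap.snd .id))
      (h.defRel.comp subset_rfl (TermMap.fst (TermMap.fst .id)) (TermMap.snd .id)))
  -- Moving the lower bound b₀ to the upper bound b₁ gives a member H(a', y) disjoint from H(a, y)
  -- on q(M), although the two are nested and non-empty.
  obtain ⟨a', ha', hR⟩ := q.exists_conj p (hM.saturatedOver_union hA b₁) hb₀ hb₁ ha
  have h₄ : ∀ b ∈ q.locus, H a' b → lt b₁ b := fun b hb =>
    (hR _ hT).1 h₃ b (hθ.2 b hb)
  obtain ⟨b, hb, hb₂, hb₃⟩ : ∃ b ∈ q.locus, H a b ∧ H a' b := by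
    rcases hnest a ha a' ha' with hs | hs
    · obtain ⟨b, hb, hab⟩ := hne' a ha
      exact ⟨b, hb, hab, hs b hb hab⟩
    · obtain ⟨b, hb, hab⟩ := hne' a' ha'
      exact ⟨b, hb, hs b hb hab, hab⟩
  have h₅ : lt b b₁ := by_contra fun hn => h₂ b hb hn hb₂
  exact h.asymm (h.nbhd.2 b hb) (h.nbhd.2 _ hb₁) h₅ (h₄ b hb hb₃)

end OrderedBy

/-! ### Forking orthogonality of so-types -/

theorem not_forkingOrthogonal_iff {m n : ℕ} {x : Fin m → L.Sorts} {y : Fin n → L.Sorts}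
    (p : CompleteType A x) (q : CompleteType A y) : ¬ p.ForkingOrthogonal q ↔
      ∃ a ∈ p.locus, ∃ b ∈ q.locus, Forks A (tp (A ∪ b.coords) a) := by
  simp only [ForkingOrthogonal, Indep]
  push Not
  rfl

theorem not_forkingOrthogonal_trans (hM : Saturated M) (hA : Small A) {m n k : ℕ}
    {x : Fin m → L.Sorts} {y : Fin n → L.Sorts} {z : Fin k → L.Sorts} {p : CompleteType A x}
    {q : CompleteType A y} {r : CompleteType A z} (hp : p.IsSO) (hq : q.IsSO)
    (hpq : ¬ p.ForkingOrthogonal q) (hpr : ¬ p.ForkingOrthogonal r) :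
    ¬ q.ForkingOrthogonal r := by
  obtain ⟨lt, D, h⟩ := hp.exists_orderedBy (hM.saturatedOver hA)
  obtain ⟨lt', D', h'⟩ := hq.exists_orderedBy (hM.saturatedOver hA)
  obtain ⟨a, ha, b, hb, hf⟩ := (p.not_forkingOrthogonal_iff q).1 hpq
  obtain ⟨P, hP, hPD, hPab, a₀, ha₀, a₁, ha₁, hPb⟩ := h.exists_bound_of_forks hM hA ha hf
  obtain ⟨d, hd, c, hc, hf'⟩ := (p.not_forkingOrthogonal_iff r).1 hpr
  obtain ⟨R, hR, hRD, hRdc, d₀, hd₀, d₁, hd₁, hRc⟩ := h.exists_bound_of_forks hM hA hd hf'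
  have hDp := h.nbhd.2
  have hd₀₁ : lt d₀ d₁ := h.trans _ _ _ (hDp _ hd₀) (hDp _ hd) (hDp _ hd₁)
    (hRc d hRdc).1 (hRc d hRdc).2
  have hPne : ∀ b' ∈ q.locus, ∃ e, P e b' := fun b' hb' =>
    (q.defPred_iff hb hb' hP.exists_fst).1 ⟨a, hPab⟩
  have hG₁ : DefRel A fun a b => ∀ e, P e b → lt a e := by
    refine DefRel.forall_snd (R := fun (t : Tuple M (Sum.elim x y)) e =>
      P e t.snd → lt t.fst e) ?_
    exact DefPred.imp (hP.comp subset_rfl (TermMap.snd .id) (TermMap.snd (TermMap.fst .id)))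
      (h.defRel.comp subset_rfl (TermMap.fst (TermMap.fst .id)) (TermMap.snd .id))
  have hG₂ : DefRel A fun a b => ∀ e, P e b → lt e a := by
    refine DefRel.forall_snd (R := fun (t : Tuple M (Sum.elim x y)) e =>
      P e t.snd → lt e t.fst) ?_
    exact DefPred.imp (hP.comp subset_rfl (TermMap.snd .id) (TermMap.snd (TermMap.fst .id)))
      (h.defRel.comp subset_rfl (TermMap.snd .id) (TermMap.fst (TermMap.fst .id)))
  -- Stated for an abstract r because it is applied both to the order on p and to its reverse.
  have hnest : ∀ r : Tuple M x → Tuple M x → Prop,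
      (∀ a b c, D a → D b → D c → r a b → r b c → r a c) →
      (∀ a b c, D a → D b → D c → r a c → r a b ∨ r b c) →
      ∀ a ∈ p.locus, ∀ a' ∈ p.locus,
      (∀ b ∈ q.locus, (∀ e, P e b → r a e) → ∀ e, P e b → r a' e) ∨
      ∀ b ∈ q.locus, (∀ e, P e b → r a' e) → ∀ e, P e b → r a e := by
    intro r htrans hcotrans a ha a' ha'
    by_cases hlt : r a' a
    · exact Or.inl fun b _ hb e he =>
        htrans _ _ _ (hDp _ ha') (hDp _ ha) (hPD _ _ he) hlt (hb e he)
    · exact Or.inr fun b _ hb e he =>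
        (hcotrans _ _ _ (hDp _ ha') (hDp _ ha) (hPD _ _ he) (hb e he)).resolve_left hlt
  let K : Tuple M y → Tuple M z → Prop := fun b c => ∃ e, P e b ∧ R e c
  have hK : DefRel A K := by
    refine DefRel.exists_snd (R := fun (t : Tuple M (Sum.elim y z)) e =>
      P e t.fst ∧ R e t.snd) ?_
    exact DefPred.and (hP.comp subset_rfl (TermMap.snd .id) (TermMap.fst (TermMap.fst .id)))
      (hR.comp subset_rfl (TermMap.snd .id) (TermMap.snd (TermMap.fst .id)))
  -- Suppose P(x, b) lies above d₁ for b near one end of q(M). Then it is not below d₀ there, so by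
  -- `not_bounded_of_nested` it lies below d₀ near the other end. At both ends it misses R(x, c),
  -- which lies between d₀ and d₁.
  have core : ∀ lt' : Tuple M y → Tuple M y → Prop, q.OrderedBy lt' D' →
      q.Initially lt' (fun b => ∀ e, P e b → lt d₁ e) →
      ¬ q.Initially lt' (fun b => K b c) ∧ ¬ q.Initially (fun a b => lt' b a) fun b => K b c := by
    intro lt' h' hi
    have hi₂ : q.Initially lt' fun b => ¬ ∀ e, P e b → lt e d₀ := by
      refine hi.mono fun b' hb' hlt hn => ?_
      obtain ⟨e, he⟩ := hPne b' hb'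
      have hDe := hPD _ _ he
      exact h.asymm (hDp _ hd₀) (hDp _ hd₁) hd₀₁
        (h.trans _ _ _ (hDp _ hd₁) hDe (hDp _ hd₀) (hlt e he) (hn e he))
    have hf₂ : q.Initially (fun a b => lt' b a) fun b => ∀ e, P e b → lt e d₀ :=
      (h'.ultimately _ (hG₂.left (Set.subset_univ _) (Set.subset_univ _))).resolve_right
        (OrderedBy.not_bounded_of_nested p h' hM hA hG₂
          (hnest _ h.flip.trans h.flip.cotrans)
          ⟨a₁, ha₁, b, hb, fun e he => (hPb e he).2⟩ hd₀ hi₂)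
    refine ⟨fun hn => h'.not_initially_not hn (hi.mono ?_),
      fun hn => h'.flip.not_initially_not hn (hf₂.mono ?_)⟩
    · rintro b' - hlt ⟨e, he, he'⟩
      exact h.asymm (hDp _ hd₁) (hPD _ _ he) (hlt e he) (hRc e he').2
    · rintro b' - hlt ⟨e, he, he'⟩
      exact h.asymm (hPD _ _ he) (hDp _ hd₀) (hlt e he) (hRc e he').1
  have hKb : ¬ q.Initially lt' (fun b => K b c) ∧
      ¬ q.Initially (fun a b => lt' b a) fun b => K b c := by
    have hdef : DefPred Set.univ fun b => ∀ e, P e b → lt d₁ e :=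
      hG₁.left (Set.subset_univ _) (Set.subset_univ _)
    rcases h'.initially _ hdef with hi | hi
    · exact core lt' h' hi
    -- If P(x, b) is not above d₁ near the initial end, the nested family forces this near the final
    -- end, and the order on q is reversed.
    · refine (core _ h'.flip ((h'.ultimately _ hdef).resolve_right ?_)).symm
      exact OrderedBy.not_bounded_of_nested p h' hM hA hG₁ (hnest _ h.trans h.cotrans)
        ⟨a₀, ha₀, b, hb, fun e he => (hPb e he).1⟩ hd₁ hi
  obtain ⟨K', hK', hKD, hKK', b₀, hb₀, b₁, hb₁, hKb'⟩ := h'.exists_bound hM hA hK hKb.1 hKb.2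
  -- Moving a to d gives b' with P(d, b'), so d witnesses K(b', c).
  obtain ⟨b', hb', hbb'⟩ := p.exists_conj q (hM.saturatedOver_union hA d) ha hd hb
  exact (q.not_forkingOrthogonal_iff r).2 ⟨b', hb', c, hc, h'.forks_of_bound hM hA hK' hKD
    (hKK' b' hb' ⟨d, (hbb' P hP).1 hPab, hRdc⟩) hb₀ hb₁ hKb'⟩

/-- The bounds on P(x, b) place a strictly between two realizations of p; hence the incomparability
class of a is bounded, and a forks with itself. -/
theorem IsSO.not_forkingOrthogonal_self (hM : Saturated M) (hA : Small A) {m n : ℕ}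
    {x : Fin m → L.Sorts} {y : Fin n → L.Sorts} {p : CompleteType A x} {q : CompleteType A y}
    (hp : p.IsSO) (hpq : ¬ p.ForkingOrthogonal q) : ¬ p.ForkingOrthogonal p := by
  obtain ⟨lt, D, h⟩ := hp.exists_orderedBy (hM.saturatedOver hA)
  obtain ⟨a, ha, b, hb, hf⟩ := (p.not_forkingOrthogonal_iff q).1 hpq
  obtain ⟨P, hP, hPD, hPab, a₀, ha₀, a₁, ha₁, hPb⟩ := h.exists_bound_of_forks hM hA ha hf
  have hDp := h.nbhd.2
  have hirr := h.irrefl a (hDp a ha)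
  refine (p.not_forkingOrthogonal_iff p).2 ⟨a, ha, a, ha, h.forks_of_bound hM hA
    (R := fun e a => D e ∧ ¬ lt e a ∧ ¬ lt a e) ?_ (fun _ _ h => h.1) ⟨hDp a ha, hirr, hirr⟩
    ha₀ ha₁ ?_⟩
  · exact DefPred.and (h.nbhd.1.comp subset_rfl (TermMap.fst .id))
      (DefPred.and (DefPred.not h.defRel) (DefPred.not h.defRel.swap))
  · rintro e ⟨hDe, h₁, h₂⟩
    exact ⟨(h.cotrans _ _ _ (hDp _ ha₀) hDe (hDp _ ha) (hPb a hPab).1).resolve_right h₁,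
      (h.cotrans _ _ _ (hDp _ ha) hDe (hDp _ ha₁) (hPb a hPab).2).resolve_left h₂⟩

theorem not_forkingOrthogonal_symm (hM : Saturated M) (hA : Small A) {m n : ℕ}
    {x : Fin m → L.Sorts} {y : Fin n → L.Sorts} {p : CompleteType A x} {q : CompleteType A y}
    (hp : p.IsSO) (hq : q.IsSO) (hpq : ¬ p.ForkingOrthogonal q) : ¬ q.ForkingOrthogonal p :=
  not_forkingOrthogonal_trans hM hA hp hq hpq (hp.not_forkingOrthogonal_self hM hA hpq)

end CompleteType

end ManySorted

theorem mainTheorem11 {L : ManySorted.Language.{u, v, v'}} {M : L.Sorts → Type w}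
    [ManySorted.Structure L M] (hM : ManySorted.Saturated M)
    (A : Set (Σ s, M s)) (hA : ManySorted.Small A)
    {m n : ℕ} {x : Fin m → L.Sorts} {y : Fin n → L.Sorts}
    (p : ManySorted.CompleteType A x) (q : ManySorted.CompleteType A y)
    (hp : p.IsSO) (hq : q.IsSO) :
    (¬ p.WeaklyOrthogonal q →
      ∀ {k : ℕ} {z : Fin k → L.Sorts} (r : ManySorted.CompleteType A z),
        p.WeaklyOrthogonal r ↔ q.WeaklyOrthogonal r) ∧
    (¬ p.ForkingOrthogonal q →
      ∀ {k : ℕ} {z : Fin k → L.Sorts} (r : ManySorted.CompleteType A z),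
        p.ForkingOrthogonal r ↔ q.ForkingOrthogonal r) := by
  open ManySorted.CompleteType in
  -- After negating both sides, each direction is transitivity, the converse with p and q exchanged
  -- by symmetry.
  exact ⟨fun h k z r => not_iff_not.1 ⟨not_weaklyOrthogonal_trans hM hA hp h,
    not_weaklyOrthogonal_trans hM hA hq fun h' => h (h'.symm hM hA)⟩,
    fun h k z r => not_iff_not.1 ⟨not_forkingOrthogonal_trans hM hA hp hq h,
    not_forkingOrthogonal_trans hM hA hq hp (not_forkingOrthogonal_symm hM hA hp hq h)⟩⟩
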